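/- Let $K$ be a field. Put $p_n = 2^{2^{2^{2^n}}}$ and define words in the letters $x,y$ by $v_1 = x$ and $v_{n+1} = v_n\, y^{p_n} v_n$ for $n\ge 1$; each $v_n$ is a prefix of $v_{n+1}$, so they have a limit, a right infinite word $v_\infty$. Let $A$ be the quotient of the free algebra $K\langle x,y\rangle$ by the ideal generated by all words that are not (contiguous) subwords of $v_\infty$. Let $G$ be the group generated by $u$ and $z_n, s_n, t_n$ ($n\in\mathbb Z$) subject to the relations, for all $n,m\in\mathbb Z$, $$s_nt_m = z_{n-m}t_ms_n,\quad s_nz_m=z_ms_n,\quad t_nz_m=z_mt_n,\quad s_ns_m=s_ms_n,\quad t_nt_m=t_mt_n,$$ $$us_mu^{-1}=s_{m+1},\quad ut_mu^{-1}=t_{m+1},\quad uz_m=z_mu .$$ Let $B$ be the $K$-subalgebra of the group algebra $A[G]$ generated by the eight elements $$xs_0,\ xs_0^{-1},\ xt_0,\ xt_0^{-1},\ xu,\ xu^{-1},\ x,\ y .$$ Then the centre of $G$ is free abelian on the elements $z_n$ $(n\in\mathbb Z)$, and 1. $B$ is a finitely generated prime $K$-algebra that satisfies no nonzero polynomial identity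 over $K$; 2. $B$ has Gelfand–Kirillov dimension $2$, where $\mathrm{GKdim}(B)=\sup_V \limsup_{n\to\infty} \log(\dim_K V^n)/\log n$ over the finite-dimensional subspaces $V\ni 1$ of $B$; 3. $B$ is $\mathbb N$-graded as a $K$-algebra, with the eight generators homogeneous of degree $1$; 4. the two-sided ideal of $B$ generated by $x$ is nonzero and locally nilpotent (for each finite subset of it there is an $n$ such that all products of $n$ elements of the subset are zero); 5. the extended centre of $B$ has infinite transcendence degree over $K$. Here the extended centre is the centre of the Martindale ring of quotients of $B$, that is, of the ring of right $B$-module homomorphisms $f : I\to B$ with $I$ a nonzero two-sided ideal, two of them being identified when they agree on a nonzero two-sided ideal. In particular, over every field $K$ there is a finitely generated non-PI prime graded $K$-algebra of GK dimension two whose extended centre has infinite transcendence degree over $K$. -/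

import Mathlib

universe u v

set_option linter.unusedSectionVars false

noncomputable section

namespace ExtCentre

section Notions

/-- A (possibly noncommutative) ring is prime if it is nonzero and `a R b = 0` implies `a = 0` or
`b = 0`. -/
class IsPrimeRing (R : Type u) [Ring R] : Prop extends Nontrivial R where
  eq_zero_or : ∀ a b : R, (∀ r : R, a * r * b = 0) → a = 0 ∨ b = 0

/-- A `K`-algebra is PI if some nonzero noncommutative polynomial over `K` vanishes under all
substitutions of elements of the algebra. -/
def IsPI (K : Type u) (R : Type v) [Field K] [Ring R] [Algebra K R] : Prop :=
  ∃ f : FreeAlgebra K ℕ, f ≠ 0 ∧ ∀ ρ : ℕ → R, FreeAlgebra.lift K ρ f = 0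

/-- The Gelfand-Kirillov dimension: the supremum of `limsup log (dim V ^ n) / log n` over all
finite-dimensional subspaces `V` that contain `1`. -/
def gkDim (K : Type u) (R : Type v) [Field K] [Ring R] [Algebra K R] : EReal :=
  ⨆ (V : Submodule K R) (_ : FiniteDimensional K V) (_ : (1 : R) ∈ V),
    Filter.limsup
      (fun n : ℕ =>
        ((Real.log (Module.finrank K (V ^ n : Submodule K R)) / Real.log n : ℝ) : EReal))
      Filter.atTop

/-- A two-sided ideal is locally nilpotent if for every finite subset of it there is an `n` such
that all products of `n` elements of the subset vanish. -/
def IsLocallyNilpotent {R : Type u} [Ring R] (I : TwoSidedIdeal R) : Prop :=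
  ∀ S : Finset R, (∀ a ∈ S, a ∈ I) →
    ∃ n : ℕ, ∀ l : List R, l.length = n → (∀ a ∈ l, a ∈ S) → l.prod = 0

end Notions

section Martindale

/-- Right module homomorphisms `f : I → R` with `I` a nonzero two-sided ideal of `R`. -/
structure PartialHom (R : Type u) [Ring R] where
  dom : TwoSidedIdeal R
  dom_ne_bot : dom ≠ ⊥
  map : dom →ₗ[Rᵐᵒᵖ] R

variable {R : Type u} [Ring R]

theorem exists_ne_zero {I : TwoSidedIdeal R} (hI : I ≠ ⊥) : ∃ a ∈ I, a ≠ 0 := by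
  by_contra! h
  refine hI (TwoSidedIdeal.ext fun x => ?_)
  rw [TwoSidedIdeal.mem_bot]
  exact ⟨h x, fun hx => hx ▸ I.zero_mem⟩

theorem ne_bot_of_mem {I : TwoSidedIdeal R} {a : R} (ha : a ∈ I) (h0 : a ≠ 0) : I ≠ ⊥ := by
  rintro rfl
  exact h0 ((TwoSidedIdeal.mem_bot R).1 ha)

theorem exists_mul_mul_ne_zero [IsPrimeRing R] {a b : R} (ha : a ≠ 0) (hb : b ≠ 0) :
    ∃ r, a * r * b ≠ 0 := by
  by_contra! h
  exact (IsPrimeRing.eq_zero_or a b h).elim ha hb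

theorem inf_ne_bot [IsPrimeRing R] {I J : TwoSidedIdeal R} (hI : I ≠ ⊥) (hJ : J ≠ ⊥) :
    I ⊓ J ≠ ⊥ := by
  obtain ⟨a, ha, ha0⟩ := exists_ne_zero hI
  obtain ⟨b, hb, hb0⟩ := exists_ne_zero hJ
  obtain ⟨r, hr⟩ := exists_mul_mul_ne_zero ha0 hb0
  refine ne_bot_of_mem (a := a * r * b) ?_ hr
  rw [TwoSidedIdeal.mem_inf]
  exact ⟨I.mul_mem_right _ _ (I.mul_mem_right _ _ ha), J.mul_mem_left _ _ hb⟩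

theorem top_ne_bot [IsPrimeRing R] : (⊤ : TwoSidedIdeal R) ≠ ⊥ :=
  ne_bot_of_mem (a := (1 : R)) trivial one_ne_zero

namespace PartialHom

/-- Two partial homomorphisms are identified when they agree on a nonzero two-sided ideal. -/
def Rel (f g : PartialHom R) : Prop :=
  ∃ J : TwoSidedIdeal R, J ≠ ⊥ ∧ ∃ (hf : J ≤ f.dom) (hg : J ≤ g.dom),
    ∀ x (hx : x ∈ J), f.map ⟨x, hf hx⟩ = g.map ⟨x, hg hx⟩

theorem map_congr (f : PartialHom R) {x y : R} (h : x = y) (hx : x ∈ f.dom) (hy : y ∈ f.dom) :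
    f.map ⟨x, hx⟩ = f.map ⟨y, hy⟩ := by
  subst h; rfl

theorem map_mul (f : PartialHom R) {x : R} (hx : x ∈ f.dom) (r : R) (h : x * r ∈ f.dom) :
    f.map ⟨x * r, h⟩ = f.map ⟨x, hx⟩ * r :=
  f.map.map_smul (MulOpposite.op r) ⟨x, hx⟩

theorem map_add (f : PartialHom R) {x y : R} (hx : x ∈ f.dom) (hy : y ∈ f.dom)
    (h : x + y ∈ f.dom) : f.map ⟨x + y, h⟩ = f.map ⟨x, hx⟩ + f.map ⟨y, hy⟩ :=
  _root_.map_add f.map ⟨x, hx⟩ ⟨y, hy⟩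

/-- The restriction to a smaller nonzero ideal. -/
def restrict (f : PartialHom R) (J : TwoSidedIdeal R) (h0 : J ≠ ⊥) (h : J ≤ f.dom) :
    PartialHom R where
  dom := J
  dom_ne_bot := h0
  map :=
    { toFun := fun x => f.map ⟨x, h x.2⟩
      map_add' := fun x y => map_add f (h x.2) (h y.2) _
      map_smul' := fun r x => map_mul f (h x.2) r.unop _ }

variable [IsPrimeRing R]

theorem rel_of_agree {f g : PartialHom R}
    (h : ∀ x (hf : x ∈ f.dom) (hg : x ∈ g.dom), f.map ⟨x, hf⟩ = g.map ⟨x, hg⟩) : Rel f g :=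
  ⟨f.dom ⊓ g.dom, inf_ne_bot f.dom_ne_bot g.dom_ne_bot, inf_le_left, inf_le_right,
    fun _ _ => h _ _ _⟩

instance setoid (R : Type u) [Ring R] [IsPrimeRing R] : Setoid (PartialHom R) where
  r := Rel
  iseqv :=
    { refl := fun _ => rel_of_agree fun _ _ _ => rfl
      symm := fun ⟨J, h0, hf, hg, h⟩ => ⟨J, h0, hg, hf, fun x hx => (h x hx).symm⟩
      trans := fun ⟨J, h0, hf, _, h⟩ ⟨J', h0', _, hk, h'⟩ =>
        ⟨J ⊓ J', inf_ne_bot h0 h0', inf_le_left.trans hf, inf_le_right.trans hk,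
          fun x hx => (h x (inf_le_left (a := J) hx)).trans (h' x (inf_le_right (a := J) hx))⟩ }

/-- Left multiplication by a ring element, defined on all of `R`. -/
def ofElem (a : R) : PartialHom R where
  dom := ⊤
  dom_ne_bot := top_ne_bot
  map :=
    { toFun := fun x => a * x
      map_add' := fun x y => mul_add a x y
      map_smul' := fun r x => (mul_assoc a (x : R) r.unop).symm }

/-- The sum, defined on the intersection of the two domains. -/
def add (f g : PartialHom R) : PartialHom R where
  dom := f.dom ⊓ g.dom
  dom_ne_bot := inf_ne_bot f.dom_ne_bot g.dom_ne_bot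
  map :=
    { toFun := fun x => f.map ⟨x, (inf_le_left : f.dom ⊓ g.dom ≤ _) x.2⟩ +
        g.map ⟨x, (inf_le_right : f.dom ⊓ g.dom ≤ _) x.2⟩
      map_add' := fun x y => by
        have h1 := map_add f ((inf_le_left : f.dom ⊓ g.dom ≤ _) x.2)
          ((inf_le_left : f.dom ⊓ g.dom ≤ _) y.2)
          ((inf_le_left : f.dom ⊓ g.dom ≤ _) (x + y).2)
        have h2 := map_add g ((inf_le_right : f.dom ⊓ g.dom ≤ _) x.2)
          ((inf_le_right : f.dom ⊓ g.dom ≤ _) y.2)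
          ((inf_le_right : f.dom ⊓ g.dom ≤ _) (x + y).2)
        exact (congrArg₂ (· + ·) h1 h2).trans (add_add_add_comm _ _ _ _)
      map_smul' := fun r x => by
        have h1 := map_mul f ((inf_le_left : f.dom ⊓ g.dom ≤ _) x.2) r.unop
          ((inf_le_left : f.dom ⊓ g.dom ≤ _) (r • x).2)
        have h2 := map_mul g ((inf_le_right : f.dom ⊓ g.dom ≤ _) x.2) r.unop
          ((inf_le_right : f.dom ⊓ g.dom ≤ _) (r • x).2)
        exact (congrArg₂ (· + ·) h1 h2).trans (add_mul _ _ _).symm }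

/-- The negative. -/
def neg (f : PartialHom R) : PartialHom R where
  dom := f.dom
  dom_ne_bot := f.dom_ne_bot
  map := -f.map

/-- The largest two-sided ideal contained in the domain of definition of `f ∘ g`. -/
def compDom (f g : PartialHom R) : TwoSidedIdeal R :=
  TwoSidedIdeal.mk' {x | ∃ hx : x ∈ g.dom, ∀ r : R, g.map ⟨r * x, g.dom.mul_mem_left r x hx⟩ ∈ f.dom}
    ⟨g.dom.zero_mem, fun r => by
      rw [map_congr g (mul_zero r) _ g.dom.zero_mem]
      exact (_root_.map_zero g.map).symm ▸ f.dom.zero_mem⟩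
    (by
      rintro x y ⟨hx, hx'⟩ ⟨hy, hy'⟩
      refine ⟨g.dom.add_mem hx hy, fun r => ?_⟩
      rw [map_congr g (mul_add r x y) _
        (g.dom.add_mem (g.dom.mul_mem_left r x hx) (g.dom.mul_mem_left r y hy)),
        map_add g (g.dom.mul_mem_left r x hx) (g.dom.mul_mem_left r y hy)]
      exact f.dom.add_mem (hx' r) (hy' r))
    (by
      rintro x ⟨hx, hx'⟩
      refine ⟨g.dom.neg_mem hx, fun r => ?_⟩
      rw [map_congr g (neg_mul_comm r x).symm _ (g.dom.mul_mem_left (-r) x hx)]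
      exact hx' (-r))
    (by
      rintro x y ⟨hy, hy'⟩
      refine ⟨g.dom.mul_mem_left x y hy, fun r => ?_⟩
      rw [map_congr g (mul_assoc r x y).symm _ (g.dom.mul_mem_left (r * x) y hy)]
      exact hy' (r * x))
    (by
      rintro x y ⟨hx, hx'⟩
      refine ⟨g.dom.mul_mem_right x y hx, fun r => ?_⟩
      rw [map_congr g (mul_assoc r x y).symm _
        (g.dom.mul_mem_right _ y (g.dom.mul_mem_left r x hx)),
        map_mul g (g.dom.mul_mem_left r x hx)]
      exact f.dom.mul_mem_right _ y (hx' r))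

theorem mem_compDom {f g : PartialHom R} {x : R} : x ∈ compDom f g ↔
    ∃ hx : x ∈ g.dom, ∀ r : R, g.map ⟨r * x, g.dom.mul_mem_left r x hx⟩ ∈ f.dom := by
  unfold compDom
  rw [TwoSidedIdeal.mem_mk']
  exact Iff.rfl

theorem compDom_le (f g : PartialHom R) : compDom f g ≤ g.dom :=
  fun _ hx => (mem_compDom.1 hx).1

theorem map_mem_of_mem_compDom {f g : PartialHom R} {x : R} (hx : x ∈ compDom f g) :
    g.map ⟨x, compDom_le f g hx⟩ ∈ f.dom := by
  obtain ⟨h, h'⟩ := mem_compDom.1 hx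
  have := h' 1
  rwa [map_congr g (one_mul x) _ h] at this

theorem compDom_ne_bot (f g : PartialHom R) : compDom f g ≠ ⊥ := by
  obtain ⟨a, ha, ha0⟩ := exists_ne_zero g.dom_ne_bot
  obtain ⟨b, hb, hb0⟩ := exists_ne_zero f.dom_ne_bot
  obtain ⟨r, hr⟩ := exists_mul_mul_ne_zero ha0 hb0
  have har := g.dom.mul_mem_right a r ha
  refine ne_bot_of_mem (mem_compDom.2 ⟨g.dom.mul_mem_right _ b har, fun s => ?_⟩) hr
  rw [map_congr g (mul_assoc s (a * r) b).symm _
    (g.dom.mul_mem_right _ b (g.dom.mul_mem_left s _ har)),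
    map_mul g (g.dom.mul_mem_left s _ har)]
  exact f.dom.mul_mem_left _ _ hb

/-- The composite `f ∘ g`. -/
def comp (f g : PartialHom R) : PartialHom R where
  dom := compDom f g
  dom_ne_bot := compDom_ne_bot f g
  map :=
    { toFun := fun x => f.map ⟨g.map ⟨x, compDom_le f g x.2⟩, map_mem_of_mem_compDom x.2⟩
      map_add' := fun x y => by
        have hx := map_mem_of_mem_compDom x.2
        have hy := map_mem_of_mem_compDom y.2
        rw [← map_add f hx hy (f.dom.add_mem hx hy)]
        exact map_congr f (map_add g (compDom_le f g x.2) (compDom_le f g y.2) _) _ _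
      map_smul' := fun r x => by
        have hx := map_mem_of_mem_compDom x.2
        refine Eq.trans ?_ (map_mul f hx r.unop (f.dom.mul_mem_right _ _ hx))
        exact map_congr f (map_mul g (compDom_le f g x.2) r.unop _) _ _ }

theorem add_rel {f f' g g' : PartialHom R} (h : Rel f f') (k : Rel g g') :
    Rel (add f g) (add f' g') := by
  obtain ⟨J, h0, hf, hf', h⟩ := h
  obtain ⟨J', h0', hg, hg', k⟩ := k
  refine ⟨J ⊓ J', inf_ne_bot h0 h0', inf_le_inf hf hg, inf_le_inf hf' hg', fun x hx => ?_⟩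
  exact congrArg₂ (· + ·) (h x (inf_le_left (a := J) hx)) (k x (inf_le_right (a := J) hx))

theorem neg_rel {f f' : PartialHom R} (h : Rel f f') : Rel (neg f) (neg f') := by
  obtain ⟨J, h0, hf, hf', h⟩ := h
  exact ⟨J, h0, hf, hf', fun x hx => congrArg Neg.neg (h x hx)⟩

theorem comp_rel {f f' g g' : PartialHom R} (h : Rel f f') (k : Rel g g') :
    Rel (comp f g) (comp f' g') := by
  obtain ⟨J, h0, hf, hf', h⟩ := h
  obtain ⟨J', h0', hg, hg', k⟩ := k
  -- work on the domain of `f|J ∘ g|J'`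
  let f₁ : PartialHom R := restrict f J h0 hf
  let g₁ : PartialHom R := restrict g J' h0' hg
  have e1 : compDom f₁ g₁ ≤ compDom f g := fun x hx => by
    obtain ⟨a, b⟩ := mem_compDom.1 hx
    exact mem_compDom.2 ⟨hg a, fun r => hf (b r)⟩
  have e2 : compDom f₁ g₁ ≤ compDom f' g' := fun x hx => by
    obtain ⟨a, b⟩ := mem_compDom.1 hx
    refine mem_compDom.2 ⟨hg' a, fun r => ?_⟩
    rw [← k _ (J'.mul_mem_left r x a)]
    exact hf' (b r)
  refine ⟨compDom f₁ g₁, compDom_ne_bot f₁ g₁, e1, e2, fun x hx => ?_⟩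
  have hm : g.map ⟨x, hg (compDom_le f₁ g₁ hx)⟩ ∈ J := map_mem_of_mem_compDom hx
  exact (h _ hm).trans (map_congr f' (k x (compDom_le f₁ g₁ hx)) _ _)

end PartialHom

variable (R) [IsPrimeRing R]

/-- The (right) Martindale ring of quotients of a prime ring: right module homomorphisms from
nonzero ideals to the ring, modulo agreement on a nonzero ideal. -/
def MartindaleQuotient : Type u := Quotient (PartialHom.setoid R)

namespace MartindaleQuotient

open PartialHom

instance : Zero (MartindaleQuotient R) := ⟨Quotient.mk _ (ofElem 0)⟩
instance : One (MartindaleQuotient R) := ⟨Quotient.mk _ (ofElem 1)⟩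
instance : Add (MartindaleQuotient R) := ⟨Quotient.map₂ add fun _ _ h _ _ k => add_rel h k⟩
instance : Neg (MartindaleQuotient R) := ⟨Quotient.map neg fun _ _ h => neg_rel h⟩
instance : Mul (MartindaleQuotient R) := ⟨Quotient.map₂ comp fun _ _ h _ _ k => comp_rel h k⟩

instance : Ring (MartindaleQuotient R) where
  add_assoc := by
    rintro ⟨f⟩ ⟨g⟩ ⟨h⟩
    exact Quotient.sound (rel_of_agree fun x _ _ => add_assoc _ _ _)
  zero_add := by
    rintro ⟨f⟩
    refine Quotient.sound (rel_of_agree fun x _ _ => ?_)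
    exact (congrArg (· + _) (zero_mul x)).trans (zero_add _)
  add_zero := by
    rintro ⟨f⟩
    refine Quotient.sound (rel_of_agree fun x _ _ => ?_)
    exact (congrArg (_ + ·) (zero_mul x)).trans (add_zero _)
  add_comm := by
    rintro ⟨f⟩ ⟨g⟩
    exact Quotient.sound (rel_of_agree fun x _ _ => add_comm _ _)
  neg_add_cancel := by
    rintro ⟨f⟩
    refine Quotient.sound (rel_of_agree fun x _ _ => ?_)
    exact (neg_add_cancel _).trans (zero_mul x).symm
  mul_assoc := by
    rintro ⟨f⟩ ⟨g⟩ ⟨h⟩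
    exact Quotient.sound (rel_of_agree fun x _ _ => rfl)
  one_mul := by
    rintro ⟨f⟩
    exact Quotient.sound (rel_of_agree fun x _ _ => one_mul _)
  mul_one := by
    rintro ⟨f⟩
    exact Quotient.sound (rel_of_agree fun x _ _ => map_congr f (one_mul x) _ _)
  zero_mul := by
    rintro ⟨f⟩
    exact Quotient.sound (rel_of_agree fun x _ _ => (zero_mul _).trans (zero_mul x).symm)
  mul_zero := by
    rintro ⟨f⟩
    refine Quotient.sound (rel_of_agree fun x _ _ => ?_)
    exact ((map_congr f (zero_mul x) _ f.dom.zero_mem).trans (map_zero f.map)).trans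
      (zero_mul x).symm
  left_distrib := by
    rintro ⟨f⟩ ⟨g⟩ ⟨h⟩
    exact Quotient.sound (rel_of_agree fun x _ hg =>
      PartialHom.map_add f (map_mem_of_mem_compDom ((inf_le_left : _ ⊓ compDom f h ≤ _) hg))
        (map_mem_of_mem_compDom ((inf_le_right : compDom f g ⊓ _ ≤ _) hg)) _)
  right_distrib := by
    rintro ⟨f⟩ ⟨g⟩ ⟨h⟩
    exact Quotient.sound (rel_of_agree fun x _ _ => rfl)
  nsmul := nsmulRec
  zsmul := zsmulRec

/-- The canonical map of a prime ring to its Martindale ring of quotients. -/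
def of : R →+* MartindaleQuotient R where
  toFun a := Quotient.mk _ (ofElem a)
  map_one' := rfl
  map_zero' := rfl
  map_mul' a b := Quotient.sound (rel_of_agree fun x _ _ => mul_assoc a b x)
  map_add' a b := Quotient.sound (rel_of_agree fun x _ _ => add_mul a b x)

instance (K : Type v) [Field K] [Algebra K R] : Algebra K (MartindaleQuotient R) :=
  ((of R).comp (algebraMap K R)).toAlgebra' (by
    rintro k ⟨f⟩
    refine Quotient.sound (rel_of_agree fun x hf hg => ?_)
    have hx : x ∈ f.dom := compDom_le _ f hf
    refine (Algebra.commutes k _).trans ?_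
    refine (PartialHom.map_mul f hx _ (f.dom.mul_mem_right _ _ hx)).symm.trans ?_
    exact map_congr f (Algebra.commutes k x).symm _ _)

end MartindaleQuotient

/-- The extended centre of a prime `K`-algebra: the centre of its Martindale ring of quotients. -/
abbrev ExtendedCentre (K : Type v) [Field K] [Algebra K R] :
    Subalgebra K (MartindaleQuotient R) :=
  Subalgebra.center K (MartindaleQuotient R)

end Martindale

section Words

/-- The two letters `x` and `y`. -/
inductive Letter
  | x
  | y

/-- `p n = 2 ^ 2 ^ 2 ^ 2 ^ n`. -/
def p (n : ℕ) : ℕ := 2 ^ 2 ^ 2 ^ 2 ^ n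

/-- `word n` is the word `v (n + 1)` in the sequence given by `v 1 = x` and
`v (n + 1) = v n * y ^ p n * v n`. -/
def word : ℕ → List Letter
  | 0 => [Letter.x]
  | n + 1 => word n ++ List.replicate (p (n + 1)) Letter.y ++ word n

/-- `w` is a (contiguous) subword of the right infinite word whose prefixes are the `word n`. -/
def IsSubword (w : List Letter) : Prop := ∃ n, w <:+: word n

variable (K : Type u) [Field K]

/-- The monomial in the free algebra that belongs to a word. -/
def monomial (w : List Letter) : FreeAlgebra K Letter := (w.map (FreeAlgebra.ι K)).prod

/-- The words that are not subwords of the infinite word are set equal to zero. -/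
inductive MonomialRel : FreeAlgebra K Letter → FreeAlgebra K Letter → Prop
  | zero (w : List Letter) (h : ¬ IsSubword w) : MonomialRel (monomial K w) 0

/-- The monomial algebra `A`: the free algebra on `x`, `y` modulo the ideal generated by the words
that are not subwords of the infinite word. -/
def MonomialAlg : Type u := RingQuot (MonomialRel K)

instance : Ring (MonomialAlg K) := inferInstanceAs (Ring (RingQuot (MonomialRel K)))

instance : Algebra K (MonomialAlg K) := inferInstanceAs (Algebra K (RingQuot (MonomialRel K)))

/-- The quotient map from the free algebra. -/
def toMonomialAlg : FreeAlgebra K Letter →ₐ[K] MonomialAlg K :=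
  RingQuot.mkAlgHom K (MonomialRel K)

/-- The image of a letter in the monomial algebra. -/
def letter (a : Letter) : MonomialAlg K := toMonomialAlg K (FreeAlgebra.ι K a)

end Words

section Group

/-- The generators `u`, `z n`, `s n`, `t n` (`n : ℤ`) of the group. -/
inductive Gen
  | u
  | z (n : ℤ)
  | s (n : ℤ)
  | t (n : ℤ)

open FreeGroup in
/-- The defining relations; `Rels a b` stands for the relation `a = b`. -/
inductive Rels : FreeGroup Gen → FreeGroup Gen → Prop
  | st (n m : ℤ) : Rels (of (.s n) * of (.t m)) (of (.z (n - m)) * of (.t m) * of (.s n))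
  | sz (n m : ℤ) : Rels (of (.s n) * of (.z m)) (of (.z m) * of (.s n))
  | tz (n m : ℤ) : Rels (of (.t n) * of (.z m)) (of (.z m) * of (.t n))
  | ss (n m : ℤ) : Rels (of (.s n) * of (.s m)) (of (.s m) * of (.s n))
  | tt (n m : ℤ) : Rels (of (.t n) * of (.t m)) (of (.t m) * of (.t n))
  | us (m : ℤ) : Rels (of .u * of (.s m) * (of .u)⁻¹) (of (.s (m + 1)))
  | ut (m : ℤ) : Rels (of .u * of (.t m) * (of .u)⁻¹) (of (.t (m + 1)))
  | uz (m : ℤ) : Rels (of .u * of (.z m)) (of (.z m) * of .u)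

/-- Irving's group, given by generators and relations. -/
abbrev IrvingGroup : Type := PresentedGroup {r | ∃ a b, Rels a b ∧ r = a * b⁻¹}

/-- The image of a generator in the group. -/
def gen (g : Gen) : IrvingGroup := PresentedGroup.of g

end Group

section Example

variable (K : Type u) [Field K]

/-- The element `a g` of the group algebra `A[G]`. -/
abbrev mono (a : Letter) (g : IrvingGroup) : MonoidAlgebra (MonomialAlg K) IrvingGroup :=
  MonoidAlgebra.single g (letter K a)

/-- The elements `x s₀^{±1}`, `x t₀^{±1}`, `x u^{±1}`, `x`, `y` of `A[G]`. -/
def generators : Set (MonoidAlgebra (MonomialAlg K) IrvingGroup) :=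
  {mono K .x (gen (.s 0)), mono K .x (gen (.s 0))⁻¹,
    mono K .x (gen (.t 0)), mono K .x (gen (.t 0))⁻¹,
    mono K .x (gen .u), mono K .x (gen .u)⁻¹,
    mono K .x 1, mono K .y 1}

/-- The subalgebra `B` of `A[G]` generated by `generators`. -/
def exampleAlg : Subalgebra K (MonoidAlgebra (MonomialAlg K) IrvingGroup) :=
  Algebra.adjoin K (generators K)

/-- The element `x` of `B`. -/
def exampleX : exampleAlg K :=
  ⟨mono K .x 1, Algebra.subset_adjoin (by simp [generators])⟩

end Example

end ExtCentre

end

/-! The nonzero words of the monomial algebra are linearly independent, so `A[G]` has as basis the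
products `w g` with `w` a subword of the infinite word and `g ∈ G`. In a product of generators of
`B` each letter `x` carries `s₀^{±1}`, `t₀^{±1}`, `u^{±1}` or `1`, and `y` carries nothing. Words
commute with group elements, so `B` is spanned by the `w g` with `g` in the ball of `G` whose radius
is the number of letters `x` in `w` (`closure_generators`, `exampleAlg_eq_span`).

Everything rests on the sparsity of `x`: a subword shorter than `p (j + 1)` contains at most `2 ^ j`
of them (`IsSubword.count_le`). For words of length at most `N` the radius is then `O(√(log N))`, so
at most `N ^ o(1)` group elements occur, while the number of words is of order `N ^ 2`; this gives
dimension two. A long product of elements of the ideal of `x` would need too many letters `x` in too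
short a word, so it vanishes. Giving words their length as degree, and group elements degree `0`,
grades `B`.

Any two subwords can be joined inside a longer one, and `G` has unique products as an iterated
extension of torsion-free abelian groups; so a suitable product `f u h` keeps a nonzero coefficient
(`exists_coeff_mul_single_mul`), and `B` is prime. The blocks `y ^ p (i + 1) * word i` form a prefix
code and their product in increasing order is a subword, which defeats every polynomial identity.

A basis element whose word has `r` letters `x` to spare can absorb a factor `z n` that is a product
of `r` group generators. Such elements span a nonzero ideal, which `z n` multiplies into `B`; this
is a central element of the Martindale quotient. The normal form `z^a t^c s^b u^k` in `G` shows that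
distinct monomials in the `z n` are distinct group elements, and unique products then exclude
algebraic relations. -/

noncomputable section

namespace ExtCentre

/-! ### Unique products and group extensions. -/

section UniqueProducts

open Finset in
/-- Groups with unique products are closed under extensions. -/
theorem uniqueProds_of_ker {G Q : Type*} [Group G] [Group Q] (f : G →* Q) [UniqueProds Q]
    [UniqueProds f.ker] : UniqueProds G where
  uniqueMul_of_nonempty {A B} hA hB := by
    classical
    obtain ⟨qa, hqa, qb, hqb, hu⟩ :=
      UniqueProds.uniqueMul_of_nonempty (hA.image f) (hB.image f)
    obtain ⟨a0, ha0, ea0⟩ := mem_image.1 hqa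
    obtain ⟨b0, hb0, eb0⟩ := mem_image.1 hqb
    -- The fibres over the unique product are moved into the kernel, one by a left and the other by
    -- a right translation. Then `a * b` becomes `a0⁻¹ * (a * b) * b0⁻¹`, so coincidences of
    -- products are preserved.
    let A' : Finset f.ker :=
      (({a ∈ A | f a = qa}).image (a0⁻¹ * ·)).preimage Subtype.val Subtype.val_injective.injOn
    let B' : Finset f.ker :=
      (({b ∈ B | f b = qb}).image (· * b0⁻¹)).preimage Subtype.val Subtype.val_injective.injOn
    have hA' : A'.Nonempty := ⟨1, by
      simp only [A', mem_preimage, mem_image, mem_filter]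
      exact ⟨a0, ⟨ha0, ea0⟩, by simp⟩⟩
    have hB' : B'.Nonempty := ⟨1, by
      simp only [B', mem_preimage, mem_image, mem_filter]
      exact ⟨b0, ⟨hb0, eb0⟩, by simp⟩⟩
    obtain ⟨n, hn, m, hm, hnm⟩ := UniqueProds.uniqueMul_of_nonempty hA' hB'
    simp only [A', mem_preimage, mem_image, mem_filter] at hn
    simp only [B', mem_preimage, mem_image, mem_filter] at hm
    obtain ⟨a1, ⟨ha1, ea1⟩, hn⟩ := hn
    obtain ⟨b1, ⟨hb1, eb1⟩, hm⟩ := hm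
    refine ⟨a1, ha1, b1, hb1, UniqueMul.of_image_filter (f : G →ₙ* Q) ea1 eb1 hu ?_⟩
    intro a b ha hb hab
    simp only [mem_filter] at ha hb
    have hka : a0⁻¹ * a ∈ f.ker := by
      rw [MonoidHom.mem_ker, map_mul, map_inv, ea0]
      exact inv_mul_eq_one.2 ha.2.symm
    have hkb : b * b0⁻¹ ∈ f.ker := by
      rw [MonoidHom.mem_ker, map_mul, map_inv, eb0]
      exact mul_inv_eq_one.2 hb.2
    have key := @hnm ⟨_, hka⟩ ⟨_, hkb⟩
      (by
        simp only [A', mem_preimage, mem_image, mem_filter]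
        exact ⟨a, ⟨ha.1, ha.2⟩, rfl⟩)
      (by
        simp only [B', mem_preimage, mem_image, mem_filter]
        exact ⟨b, ⟨hb.1, hb.2⟩, rfl⟩)
      (by
        apply Subtype.ext
        simp only [Subgroup.coe_mul]
        rw [← hn, ← hm]
        calc a0⁻¹ * a * (b * b0⁻¹) = a0⁻¹ * (a * b) * b0⁻¹ := by group
          _ = a0⁻¹ * (a1 * b1) * b0⁻¹ := by rw [hab]
          _ = _ := by group)
    have k1 := congrArg Subtype.val key.1
    have k2 := congrArg Subtype.val key.2
    simp only at k1 k2
    rw [← hn] at k1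
    rw [← hm] at k2
    exact ⟨mul_left_cancel k1, mul_right_cancel k2⟩

end UniqueProducts

/-! ### A concrete model of the group. -/

section Model

open LaurentPolynomial

/-- A concrete model of the group, with Laurent polynomials recording the exponents of the
`z n`, `t n` and `s n`, and an integer that of `u`. -/
@[ext]
structure Model where
  a : ℤ[T;T⁻¹]
  b : ℤ[T;T⁻¹]
  c : ℤ[T;T⁻¹]
  k : ℤ

namespace Model

instance : One Model := ⟨⟨0, 0, 0, 0⟩⟩
-- The tuple stands for `z^a t^c s^b u^k`. Moving `u^k` to the right multiplies later exponents by
-- `T k`; moving `s^b` past `t^(T k * c')` creates `z` with exponent `b * invert (T k * c')`, since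
-- `s n` and `t m` produce `z (n - m)`.
instance : Mul Model := ⟨fun m n =>
  ⟨m.a + n.a + m.b * T (-m.k) * invert n.c, m.b + T m.k * n.b, m.c + T m.k * n.c, m.k + n.k⟩⟩
instance : Inv Model := ⟨fun m =>
  ⟨-m.a + m.b * invert m.c, -(T (-m.k) * m.b), -(T (-m.k) * m.c), -m.k⟩⟩

@[simp] theorem one_a : (1 : Model).a = 0 := rfl
@[simp] theorem one_b : (1 : Model).b = 0 := rfl
@[simp] theorem one_c : (1 : Model).c = 0 := rfl
@[simp] theorem one_k : (1 : Model).k = 0 := rfl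
@[simp] theorem mul_a (m n : Model) :
    (m * n).a = m.a + n.a + m.b * T (-m.k) * invert n.c := rfl
@[simp] theorem mul_b (m n : Model) : (m * n).b = m.b + T m.k * n.b := rfl
@[simp] theorem mul_c (m n : Model) : (m * n).c = m.c + T m.k * n.c := rfl
@[simp] theorem mul_k (m n : Model) : (m * n).k = m.k + n.k := rfl
@[simp] theorem inv_a (m : Model) : m⁻¹.a = -m.a + m.b * invert m.c := rfl
@[simp] theorem inv_b (m : Model) : m⁻¹.b = -(T (-m.k) * m.b) := rfl
@[simp] theorem inv_c (m : Model) : m⁻¹.c = -(T (-m.k) * m.c) := rfl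
@[simp] theorem inv_k (m : Model) : m⁻¹.k = -m.k := rfl

theorem T_mul_T_neg (k : ℤ) : (T k : ℤ[T;T⁻¹]) * T (-k) = 1 := by
  rw [← T_add, add_neg_cancel, T_zero]

instance : Group Model := Group.ofLeftAxioms
  (by
    intro x y z
    ext1
    · simp only [mul_a, mul_b, mul_c, mul_k, map_add, map_mul, invert_T, neg_add, T_add]
      linear_combination (y.b * T (-y.k) * invert z.c) * T_mul_T_neg x.k
    · simp only [mul_b, mul_k, T_add]; ring
    · simp only [mul_c, mul_k, T_add]; ring
    · simp only [mul_k]; ring)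
  (by intro x; ext1 <;> simp)
  (by
    intro x
    ext1
    · simp only [mul_a, inv_a, inv_b, inv_k, neg_neg, one_a]
      linear_combination (-(x.b * invert x.c)) * T_mul_T_neg x.k
    · simp
    · simp
    · simp)

/-- The images of the generators in the model. -/
def ofGen : Gen → Model
  | .u => ⟨0, 0, 0, 1⟩
  | .z n => ⟨T n, 0, 0, 0⟩
  | .s n => ⟨0, T n, 0, 0⟩
  | .t n => ⟨0, 0, T n, 0⟩

/-- The homomorphism `k`, then `(b, c)` on its kernel, then `a` on the next kernel exhibit the model
as an iterated extension of groups that are additively free abelian. -/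
theorem uniqueProds : UniqueProds Model := by
  have hR : UniqueProds (Multiplicative ℤ[T;T⁻¹]) :=
    UniqueProds.of_injective_mulHom (G := Multiplicative (ℤ →₀ ℤ))
      (AddMonoidHom.toMultiplicative
        (AddMonoidAlgebra.coeffAddEquiv (R := ℤ) (M := ℤ)).toAddMonoidHom : _ →* _)
      (AddMonoidAlgebra.coeffAddEquiv (R := ℤ) (M := ℤ)).injective inferInstance
  let f : Model →* Multiplicative ℤ :=
    { toFun := fun m => .ofAdd m.k, map_one' := rfl, map_mul' := fun _ _ => rfl }
  have hf : ∀ m : f.ker, m.1.k = 0 := fun m => m.2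
  let g : f.ker →* Multiplicative (ℤ[T;T⁻¹] × ℤ[T;T⁻¹]) :=
    { toFun := fun m => .ofAdd (m.1.b, m.1.c)
      map_one' := rfl
      map_mul' := fun m n => by
        apply congrArg Multiplicative.ofAdd
        simp [hf m] }
  have hg : ∀ m : g.ker, m.1.1.b = 0 ∧ m.1.1.c = 0 := fun m => by
    have : (m.1.1.b, m.1.1.c) = ((0, 0) : ℤ[T;T⁻¹] × ℤ[T;T⁻¹]) := m.2
    exact ⟨congrArg Prod.fst this, congrArg Prod.snd this⟩
  let h : g.ker →* Multiplicative ℤ[T;T⁻¹] :=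
    { toFun := fun m => .ofAdd m.1.1.a
      map_one' := rfl
      map_mul' := fun m n => by
        apply congrArg Multiplicative.ofAdd
        simp [(hg m).1] }
  have hh : Function.Injective h := fun m n hmn => by
    have : m.1.1.a = n.1.1.a := hmn
    apply Subtype.ext
    apply Subtype.ext
    ext1
    · exact this
    · rw [(hg m).1, (hg n).1]
    · rw [(hg m).2, (hg n).2]
    · rw [hf, hf]
  have i1 : UniqueProds g.ker := UniqueProds.of_injective_mulHom (h : _ →ₙ* _) hh hR
  have i3 : UniqueProds (Multiplicative (ℤ[T;T⁻¹] × ℤ[T;T⁻¹])) :=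
    UniqueProds.of_injective_mulHom
      (G := Multiplicative ℤ[T;T⁻¹] × Multiplicative ℤ[T;T⁻¹])
      (⟨fun x => (.ofAdd x.toAdd.1, .ofAdd x.toAdd.2), fun _ _ => rfl⟩)
      (fun x y hxy => by
        have h1 : x.toAdd.1 = y.toAdd.1 := congrArg (fun z => z.1.toAdd) hxy
        have h2 : x.toAdd.2 = y.toAdd.2 := congrArg (fun z => z.2.toAdd) hxy
        exact congrArg Multiplicative.ofAdd (Prod.ext h1 h2)) inferInstance
  have i2 : UniqueProds f.ker := uniqueProds_of_ker g
  exact uniqueProds_of_ker f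

/-- Commuting with `u` makes `T 1 - 1` annihilate `b` and `c`, and Laurent polynomials over `ℤ` form
a domain. Commuting with `s 0` then forces `T k = 1`. -/
theorem mem_center_iff {m : Model} :
    m ∈ Subgroup.center Model ↔ m.b = 0 ∧ m.c = 0 ∧ m.k = 0 := by
  have hT : (T 1 : ℤ[T;T⁻¹]) - 1 ≠ 0 := fun h => by
    have := congrArg (fun p => p.coeff 1) h
    rw [← T_zero] at this
    simp [-T_zero] at this
  constructor
  · intro hm
    have hu := Subgroup.mem_center_iff.1 hm (ofGen .u)
    have hs := Subgroup.mem_center_iff.1 hm (ofGen (.s 0))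
    have h1 : T 1 * m.b = m.b := by simpa [ofGen] using congrArg Model.b hu
    have h2 : T 1 * m.c = m.c := by simpa [ofGen] using congrArg Model.c hu
    have hb : m.b = 0 := by
      refine (mul_eq_zero.1 (?_ : (T 1 - 1) * m.b = 0)).resolve_left hT
      rw [sub_mul, h1, one_mul, sub_self]
    have hc : m.c = 0 := by
      refine (mul_eq_zero.1 (?_ : (T 1 - 1) * m.c = 0)).resolve_left hT
      rw [sub_mul, h2, one_mul, sub_self]
    refine ⟨hb, hc, ?_⟩
    have h3 : (1 : ℤ[T;T⁻¹]) = T m.k := by simpa [ofGen, hb] using congrArg Model.b hs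
    by_contra hk
    have := congrArg (fun p => p.coeff 0) h3
    rw [← T_zero] at this
    simp [-T_zero, hk] at this
  · rintro ⟨h1, h2, h3⟩
    refine Subgroup.mem_center_iff.2 fun g => ?_
    ext1 <;> simp [h1, h2, h3, add_comm]

end Model

section CommHom

variable {G : Type*} [Group G]

/-- The homomorphism from the additive group of Laurent polynomials given by a commuting family. -/
def commHom (f : ℤ → G) (h : ∀ m n, f m * f n = f n * f m) : Multiplicative ℤ[T;T⁻¹] →* G :=
  -- The subgroup generated by a commuting family is commutative, so the universal property of free
  -- abelian groups applies inside it.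
  letI : CommGroup (Subgroup.closure (Set.range f)) :=
    { Subgroup.toGroup _ with
      mul_comm := (Subgroup.isMulCommutative_closure
        (by rintro _ ⟨m, rfl⟩ _ ⟨n, rfl⟩; exact h m n)).is_comm.comm }
  (Subgroup.closure (Set.range f)).subtype.comp
    (AddMonoidHom.toMultiplicativeLeft
      ((Finsupp.liftAddHom fun n => zmultiplesHom (Additive (Subgroup.closure (Set.range f)))
        (.ofMul ⟨f n, Subgroup.subset_closure ⟨n, rfl⟩⟩)).comp
        (AddMonoidAlgebra.coeffAddEquiv (R := ℤ) (M := ℤ)).toAddMonoidHom))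

theorem commHom_T (f : ℤ → G) (h : ∀ m n, f m * f n = f n * f m) (n : ℤ) :
    commHom f h (.ofAdd (T n)) = f n := by
  have : AddMonoidAlgebra.coeff (T n : ℤ[T;T⁻¹]) = Finsupp.single n 1 := rfl
  simp [commHom, this]

attribute [irreducible] commHom

theorem laurent_hom_ext {f g : Multiplicative ℤ[T;T⁻¹] →* G}
    (h : ∀ n, f (.ofAdd (T n)) = g (.ofAdd (T n))) : f = g := by
  have key : ∀ p : ℤ[T;T⁻¹], f (.ofAdd p) = g (.ofAdd p) := by
    intro p
    induction p using LaurentPolynomial.induction_on' with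
    | add p q hp hq => rw [ofAdd_add, map_mul, map_mul, hp, hq]
    | C_mul_T n a =>
      have : (C a * T n : ℤ[T;T⁻¹]) = a • T n := by
        rw [LaurentPolynomial.smul_eq_C_mul]
      rw [this, ofAdd_zsmul, map_zpow, map_zpow, h]
  exact MonoidHom.ext fun p => key p.toAdd

end CommHom

/-! ### Normal forms, and the centre of the group. -/

section Iso

theorem of_rel {a b : FreeGroup Gen} (h : Rels a b) :
    (PresentedGroup.mk _ a : IrvingGroup) = PresentedGroup.mk _ b := by
  rw [← mul_inv_eq_one, ← map_inv, ← map_mul, PresentedGroup.mk_eq_one_iff]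
  exact Subgroup.subset_normalClosure ⟨a, b, h, rfl⟩

theorem gen_st (n m : ℤ) :
    gen (.s n) * gen (.t m) = gen (.z (n - m)) * gen (.t m) * gen (.s n) :=
  of_rel (.st n m)

theorem gen_sz (n m : ℤ) : gen (.s n) * gen (.z m) = gen (.z m) * gen (.s n) := of_rel (.sz n m)

theorem gen_tz (n m : ℤ) : gen (.t n) * gen (.z m) = gen (.z m) * gen (.t n) := of_rel (.tz n m)

theorem gen_ss (n m : ℤ) : gen (.s n) * gen (.s m) = gen (.s m) * gen (.s n) := of_rel (.ss n m)

theorem gen_tt (n m : ℤ) : gen (.t n) * gen (.t m) = gen (.t m) * gen (.t n) := of_rel (.tt n m)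

theorem gen_us (m : ℤ) : gen .u * gen (.s m) * (gen .u)⁻¹ = gen (.s (m + 1)) := of_rel (.us m)

theorem gen_ut (m : ℤ) : gen .u * gen (.t m) * (gen .u)⁻¹ = gen (.t (m + 1)) := of_rel (.ut m)

theorem gen_uz (m : ℤ) : gen .u * gen (.z m) = gen (.z m) * gen .u := of_rel (.uz m)

theorem closure_gen : Subgroup.closure (Set.range gen) = ⊤ := PresentedGroup.closure_range_of _

/-- Commutation among the `z` is not a defining relation. It follows since `z n` is the commutator
of `s n` and `t 0`, both of which commute with `z m`. -/
theorem gen_zz (n m : ℤ) : gen (.z n) * gen (.z m) = gen (.z m) * gen (.z n) := by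
  have hz : gen (.z n) = gen (.s n) * gen (.t 0) * (gen (.s n))⁻¹ * (gen (.t 0))⁻¹ := by
    rw [gen_st, sub_zero]; group
  have h1 : Commute (gen (.s n)) (gen (.z m)) := gen_sz n m
  have h2 : Commute (gen (.t 0)) (gen (.z m)) := gen_tz 0 m
  rw [hz]
  exact ((h1.mul_left h2).mul_left h1.inv_left).mul_left h2.inv_left

theorem gen_z_comm (m : ℤ) (g : IrvingGroup) : gen (.z m) * g = g * gen (.z m) := by
  have hg : g ∈ Subgroup.closure (Set.range gen) := closure_gen ▸ Subgroup.mem_top g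
  refine (?_ : Commute (gen (.z m)) g)
  induction hg using Subgroup.closure_induction with
  | mem x hx =>
    obtain ⟨x | n | n | n, rfl⟩ := hx
    · exact (gen_uz m).symm
    · exact gen_zz m n
    · exact (gen_sz n m).symm
    · exact (gen_tz n m).symm
  | one => exact Commute.one_right _
  | mul x y _ _ hx hy => exact hx.mul_right hy
  | inv x _ hx => exact hx.inv_right

/-- The homomorphism from the group to its model. -/
def toModel : IrvingGroup →* Model :=
  PresentedGroup.toGroup (f := Model.ofGen) (by
    rintro _ ⟨a, b, h, rfl⟩
    rw [map_mul, map_inv, mul_inv_eq_one]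
    cases h <;> ext1 <;>
      simp only [map_mul, map_inv, FreeGroup.lift_apply_of, Model.ofGen, Model.mul_a, Model.mul_b,
        Model.mul_c, Model.mul_k, Model.inv_a, Model.inv_b, Model.inv_c, Model.inv_k, invert_T,
        neg_zero, T_zero, mul_one, one_mul, mul_zero, zero_mul, add_zero, zero_add, ← T_add,
        map_zero, add_comm, sub_eq_add_neg, add_neg_cancel])

@[simp] theorem toModel_gen (g : Gen) : toModel (gen g) = Model.ofGen g :=
  PresentedGroup.toGroup.of _

/-- The homomorphism with values on the `z n`. -/
def zHom : Multiplicative ℤ[T;T⁻¹] →* IrvingGroup := commHom (fun n => gen (.z n)) gen_zz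

/-- The homomorphism with values on the `s n`. -/
def sHom : Multiplicative ℤ[T;T⁻¹] →* IrvingGroup := commHom (fun n => gen (.s n)) gen_ss

/-- The homomorphism with values on the `t n`. -/
def tHom : Multiplicative ℤ[T;T⁻¹] →* IrvingGroup := commHom (fun n => gen (.t n)) gen_tt

@[simp] theorem zHom_T (n : ℤ) : zHom (.ofAdd (T n)) = gen (.z n) := commHom_T _ _ _
@[simp] theorem sHom_T (n : ℤ) : sHom (.ofAdd (T n)) = gen (.s n) := commHom_T _ _ _
@[simp] theorem tHom_T (n : ℤ) : tHom (.ofAdd (T n)) = gen (.t n) := commHom_T _ _ _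

attribute [irreducible] zHom sHom tHom

theorem zHom_comm (p : Multiplicative ℤ[T;T⁻¹]) (g : IrvingGroup) :
    zHom p * g = g * zHom p := by
  have : (MulAut.conj g).toMonoidHom.comp zHom = zHom := laurent_hom_ext fun n => by
    simp [← gen_z_comm]
  have := DFunLike.congr_fun this p
  simp only [MonoidHom.comp_apply, MulEquiv.coe_toMonoidHom, MulAut.conj_apply] at this
  nth_rw 1 [← this]
  group

/-- Conjugation by `s n` and the map `f` below are both homomorphisms, the latter because the `z`
are central, so it suffices to compare them on the `t m`. -/
theorem gen_s_mul_tHom (n : ℤ) (c : ℤ[T;T⁻¹]) :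
    gen (.s n) * tHom (.ofAdd c) =
      zHom (.ofAdd (T n * invert c)) * tHom (.ofAdd c) * gen (.s n) := by
  let f : Multiplicative ℤ[T;T⁻¹] →* IrvingGroup :=
    { toFun := fun p => zHom (.ofAdd (T n * invert p.toAdd)) * tHom p
      map_one' := by simp
      map_mul' := fun p q => by
        simp only [toAdd_mul, map_add, mul_add, ofAdd_add, map_mul]
        rw [mul_assoc, mul_assoc, ← mul_assoc (zHom _) (tHom p), zHom_comm _ (tHom p), mul_assoc] }
  have : (MulAut.conj (gen (.s n))).toMonoidHom.comp tHom = f := laurent_hom_ext fun m => by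
    simp only [f, MonoidHom.comp_apply, MulEquiv.coe_toMonoidHom, MulAut.conj_apply, tHom_T,
      MonoidHom.coe_mk, OneHom.coe_mk, toAdd_ofAdd, invert_T, gen_st, ← T_add, zHom_T,
      sub_eq_add_neg, mul_inv_cancel_right]
  have := DFunLike.congr_fun this (.ofAdd c)
  simp only [MonoidHom.comp_apply, MulEquiv.coe_toMonoidHom, MulAut.conj_apply] at this
  exact mul_inv_eq_iff_eq_mul.1 this

theorem gen_u_mul_tHom (c : ℤ[T;T⁻¹]) :
    gen .u * tHom (.ofAdd c) = tHom (.ofAdd (T 1 * c)) * gen .u := by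
  have : (MulAut.conj (gen .u)).toMonoidHom.comp tHom =
      tHom.comp (AddMonoidHom.toMultiplicative (AddMonoidHom.mulLeft (T 1))) :=
    laurent_hom_ext fun m => by
      simp only [MonoidHom.comp_apply, MulEquiv.coe_toMonoidHom, MulAut.conj_apply, tHom_T,
        AddMonoidHom.toMultiplicative_apply_apply, toAdd_ofAdd, AddMonoidHom.coe_mulLeft, ← T_add,
        gen_ut, add_comm 1 m]
  have := DFunLike.congr_fun this (.ofAdd c)
  simp only [MonoidHom.comp_apply, MulEquiv.coe_toMonoidHom, MulAut.conj_apply] at this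
  exact mul_inv_eq_iff_eq_mul.1 this

theorem gen_u_mul_sHom (c : ℤ[T;T⁻¹]) :
    gen .u * sHom (.ofAdd c) = sHom (.ofAdd (T 1 * c)) * gen .u := by
  have : (MulAut.conj (gen .u)).toMonoidHom.comp sHom =
      sHom.comp (AddMonoidHom.toMultiplicative (AddMonoidHom.mulLeft (T 1))) :=
    laurent_hom_ext fun m => by
      simp only [MonoidHom.comp_apply, MulEquiv.coe_toMonoidHom, MulAut.conj_apply, sHom_T,
        AddMonoidHom.toMultiplicative_apply_apply, toAdd_ofAdd, AddMonoidHom.coe_mulLeft, ← T_add,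
        gen_us, add_comm 1 m]
  have := DFunLike.congr_fun this (.ofAdd c)
  simp only [MonoidHom.comp_apply, MulEquiv.coe_toMonoidHom, MulAut.conj_apply] at this
  exact mul_inv_eq_iff_eq_mul.1 this

/-- The normal form of a group element with given image in the model. -/
def ofModel (m : Model) : IrvingGroup :=
  zHom (.ofAdd m.a) * tHom (.ofAdd m.c) * sHom (.ofAdd m.b) * gen .u ^ m.k

/-- Multiplying a normal form on the left by a generator gives the normal form predicted by the
model; products and inverses follow. With `m = 1` this recovers `g` from `toModel g`, whence
`toModel_injective`. -/
theorem ofModel_mul (g : IrvingGroup) (m : Model) : ofModel (toModel g * m) = g * ofModel m := by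
  have hg : g ∈ Subgroup.closure (Set.range gen) := closure_gen ▸ Subgroup.mem_top g
  induction hg using Subgroup.closure_induction generalizing m with
  | mem x hx =>
    obtain ⟨x | n | n | n, rfl⟩ := hx
    · simp only [toModel_gen, Model.ofGen, ofModel, Model.mul_a, Model.mul_b, Model.mul_c,
        Model.mul_k, zero_mul, zero_add, add_zero, zpow_add, zpow_one]
      simp only [← mul_assoc]
      rw [← zHom_comm, mul_assoc (zHom _) (gen .u), gen_u_mul_tHom]
      simp only [mul_assoc]
      rw [← mul_assoc (gen .u) (sHom _), gen_u_mul_sHom]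
      simp only [mul_assoc]
    · simp only [toModel_gen, Model.ofGen, ofModel, Model.mul_a, Model.mul_b, Model.mul_c,
        Model.mul_k, zero_mul, zero_add, add_zero, T_zero, one_mul, ofAdd_add, map_mul, zHom_T]
      simp only [mul_assoc]
    · simp only [toModel_gen, Model.ofGen, ofModel, Model.mul_a, Model.mul_b, Model.mul_c,
        Model.mul_k, zero_add, T_zero, one_mul, ofAdd_add, map_mul, sHom_T,
        neg_zero, mul_one]
      simp only [← mul_assoc]
      rw [← zHom_comm _ (gen _), mul_assoc _ (gen _) (tHom _), gen_s_mul_tHom]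
      simp only [← mul_assoc]
    · simp only [toModel_gen, Model.ofGen, ofModel, Model.mul_a, Model.mul_b, Model.mul_c,
        Model.mul_k, zero_mul, zero_add, add_zero, T_zero, one_mul, ofAdd_add, map_mul, tHom_T]
      simp only [← mul_assoc]
      rw [← zHom_comm]
  | one => simp
  | mul x y _ _ hx hy => rw [map_mul, mul_assoc, hx, hy, mul_assoc]
  | inv x _ hx =>
    rw [eq_inv_mul_iff_mul_eq, ← hx, map_inv, mul_inv_cancel_left]

theorem toModel_injective : Function.Injective toModel := fun g h hgh => by
  have h1 := ofModel_mul g 1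
  have h2 := ofModel_mul h 1
  rw [hgh, h2] at h1
  exact (mul_right_cancel h1).symm

theorem toModel_zHom (p : ℤ[T;T⁻¹]) : toModel (zHom (.ofAdd p)) = ⟨p, 0, 0, 0⟩ := by
  let f : Multiplicative ℤ[T;T⁻¹] →* Model :=
    { toFun := fun p => ⟨p.toAdd, 0, 0, 0⟩
      map_one' := rfl
      map_mul' := fun p q => by ext1 <;> simp }
  exact DFunLike.congr_fun
    (laurent_hom_ext fun n => by simp [f, Model.ofGen] : toModel.comp zHom = f) (.ofAdd p)

theorem toModel_tHom (p : ℤ[T;T⁻¹]) : toModel (tHom (.ofAdd p)) = ⟨0, 0, p, 0⟩ := by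
  let f : Multiplicative ℤ[T;T⁻¹] →* Model :=
    { toFun := fun p => ⟨0, 0, p.toAdd, 0⟩
      map_one' := rfl
      map_mul' := fun p q => by ext1 <;> simp }
  exact DFunLike.congr_fun
    (laurent_hom_ext fun n => by simp [f, Model.ofGen] : toModel.comp tHom = f) (.ofAdd p)

theorem toModel_sHom (p : ℤ[T;T⁻¹]) : toModel (sHom (.ofAdd p)) = ⟨0, p, 0, 0⟩ := by
  let f : Multiplicative ℤ[T;T⁻¹] →* Model :=
    { toFun := fun p => ⟨0, p.toAdd, 0, 0⟩
      map_one' := rfl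
      map_mul' := fun p q => by ext1 <;> simp }
  exact DFunLike.congr_fun
    (laurent_hom_ext fun n => by simp [f, Model.ofGen] : toModel.comp sHom = f) (.ofAdd p)

theorem toModel_u_zpow (k : ℤ) : toModel (gen .u ^ k) = ⟨0, 0, 0, k⟩ := by
  let f : Multiplicative ℤ →* Model :=
    { toFun := fun p => ⟨0, 0, 0, p.toAdd⟩
      map_one' := rfl
      map_mul' := fun p q => by ext1 <;> simp }
  have := map_zpow f (.ofAdd 1) k
  rw [← ofAdd_zsmul, zsmul_one] at this
  rw [map_zpow, toModel_gen]
  exact this.symm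

theorem toModel_ofModel (m : Model) : toModel (ofModel m) = m := by
  rw [ofModel, map_mul, map_mul, map_mul, toModel_zHom, toModel_sHom, toModel_tHom, toModel_u_zpow]
  ext1 <;> simp

instance : UniqueProds IrvingGroup :=
  UniqueProds.of_injective_mulHom (toModel : _ →ₙ* _) toModel_injective Model.uniqueProds

theorem mem_center_iff_zHom {g : IrvingGroup} :
    g ∈ Subgroup.center IrvingGroup ↔ ∃ p, zHom p = g := by
  constructor
  · intro hg
    have : toModel g ∈ Subgroup.center Model := Subgroup.mem_center_iff.2 fun m => by
      rw [← toModel_ofModel m, ← map_mul, ← map_mul, Subgroup.mem_center_iff.1 hg]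
    obtain ⟨h1, h2, h3⟩ := Model.mem_center_iff.1 this
    refine ⟨.ofAdd (toModel g).a, toModel_injective ?_⟩
    rw [toModel_zHom]
    ext1 <;> simp [h1, h2, h3]
  · rintro ⟨p, rfl⟩
    exact Subgroup.mem_center_iff.2 fun h => (zHom_comm p h).symm

theorem zHom_injective : Function.Injective zHom := fun p q h => by
  have := congrArg (fun g => (toModel g).a) h
  rw [← ofAdd_toAdd p, ← ofAdd_toAdd q, toModel_zHom, toModel_zHom] at this
  exact congrArg Multiplicative.ofAdd this

theorem exists_center_equiv :
    ∃ e : Multiplicative (FreeAbelianGroup ℤ) ≃* Subgroup.center IrvingGroup,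
      ∀ n : ℤ, (e (Multiplicative.ofAdd (FreeAbelianGroup.of n)) : IrvingGroup) = gen (.z n) := by
  let e₁ : Multiplicative (FreeAbelianGroup ℤ) ≃* Multiplicative ℤ[T;T⁻¹] :=
    AddEquiv.toMultiplicative ((FreeAbelianGroup.equivFinsupp ℤ).trans
      (AddMonoidAlgebra.coeffAddEquiv (R := ℤ) (M := ℤ)).symm)
  let f := zHom.codRestrict (Subgroup.center IrvingGroup) fun p => mem_center_iff_zHom.2 ⟨p, rfl⟩
  let e₂ : Multiplicative ℤ[T;T⁻¹] ≃* Subgroup.center IrvingGroup := MulEquiv.ofBijective f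
    ⟨fun p q h => zHom_injective (congrArg Subtype.val h), fun g => by
      obtain ⟨p, hp⟩ := mem_center_iff_zHom.1 g.2
      exact ⟨p, Subtype.ext hp⟩⟩
  refine ⟨e₁.trans e₂, fun n => ?_⟩
  have : e₁ (.ofAdd (FreeAbelianGroup.of n)) = .ofAdd (T n) := by
    simp [e₁]
  rw [MulEquiv.trans_apply, this]
  exact zHom_T n

end Iso

/-! ### Balls in the group. -/

section Balls

open Pointwise

/-- The generating set `1, s₀^{±1}, t₀^{±1}, u^{±1}` of the group. -/
def groupGens : Set IrvingGroup :=
  {gen (.s 0), (gen (.s 0))⁻¹, gen (.t 0), (gen (.t 0))⁻¹, gen .u, (gen .u)⁻¹, 1}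

theorem one_mem_groupGens : 1 ∈ groupGens := by simp [groupGens]

theorem groupGens_finite : groupGens.Finite := by simp [groupGens]

theorem groupGens_inv : groupGens⁻¹ = groupGens := by
  ext g
  simp only [groupGens, Set.mem_inv, Set.mem_insert_iff, Set.mem_singleton_iff, inv_eq_iff_eq_inv,
    inv_inv, inv_one]
  tauto

theorem ball_mono {m n : ℕ} (h : m ≤ n) : groupGens ^ m ⊆ groupGens ^ n :=
  Set.pow_subset_pow_right one_mem_groupGens h

theorem mul_mem_ball {m n : ℕ} {g h : IrvingGroup} (hg : g ∈ groupGens ^ m)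
    (hh : h ∈ groupGens ^ n) : g * h ∈ groupGens ^ (m + n) := by
  rw [pow_add]; exact Set.mul_mem_mul hg hh

/-- The balls exhaust a subgroup because `groupGens` is symmetric. It contains all `s n` and `t n`
by conjugation with `u`, and then `z n` by the relation for `s n` and `t 0`. -/
theorem exists_mem_ball (g : IrvingGroup) : ∃ n, g ∈ groupGens ^ n := by
  let H : Subgroup IrvingGroup :=
    { carrier := {g | ∃ n, g ∈ groupGens ^ n}
      mul_mem' := fun ⟨m, hm⟩ ⟨n, hn⟩ => ⟨m + n, mul_mem_ball hm hn⟩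
      one_mem' := ⟨0, by simp⟩
      inv_mem' := fun {g} ⟨n, hn⟩ => ⟨n, by rwa [← groupGens_inv, inv_pow, Set.inv_mem_inv]⟩ }
  have hs0 : gen (.s 0) ∈ H := ⟨1, by simp [groupGens]⟩
  have ht0 : gen (.t 0) ∈ H := ⟨1, by simp [groupGens]⟩
  have hu : gen .u ∈ H := ⟨1, by simp [groupGens]⟩
  have hs : ∀ n, gen (.s n) ∈ H := by
    intro n
    induction n with
    | zero => exact hs0
    | succ n ih => rw [← gen_us]; exact H.mul_mem (H.mul_mem hu ih) (H.inv_mem hu)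
    | pred n ih =>
      have := gen_us (-n - 1)
      rw [sub_add_cancel] at this
      rw [← this] at ih
      exact (H.mul_mem_cancel_left hu).1 ((H.mul_mem_cancel_right (H.inv_mem hu)).1 ih)
  have ht : ∀ n, gen (.t n) ∈ H := by
    intro n
    induction n with
    | zero => exact ht0
    | succ n ih => rw [← gen_ut]; exact H.mul_mem (H.mul_mem hu ih) (H.inv_mem hu)
    | pred n ih =>
      have := gen_ut (-n - 1)
      rw [sub_add_cancel] at this
      rw [← this] at ih
      exact (H.mul_mem_cancel_left hu).1 ((H.mul_mem_cancel_right (H.inv_mem hu)).1 ih)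
  have hz : ∀ n, gen (.z n) ∈ H := fun n => by
    have h := gen_st n 0
    have h1 := H.mul_mem (hs n) ht0
    rw [h, sub_zero] at h1
    exact (H.mul_mem_cancel_right ht0).1 ((H.mul_mem_cancel_right (hs n)).1 h1)
  have : Subgroup.closure (Set.range gen) ≤ H := by
    rw [Subgroup.closure_le]
    rintro _ ⟨_ | n | n | n, rfl⟩
    exacts [hu, hz n, hs n, ht n]
  exact this (closure_gen ▸ Subgroup.mem_top g)

end Balls

end Model

/-! ### Subwords of the infinite word. -/

section WordCombinatorics

open List

instance : DecidableEq Letter := fun a b =>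
  match a, b with
  | .x, .x => isTrue rfl
  | .y, .y => isTrue rfl
  | .x, .y => isFalse (by simp)
  | .y, .x => isFalse (by simp)

/-- The word `y ^ k`. -/
abbrev ys (k : ℕ) : List Letter := replicate k .y

theorem word_succ (n : ℕ) : word (n + 1) = word n ++ ys (p (n + 1)) ++ word n := rfl

theorem p_strictMono : StrictMono p := fun a b h => by
  unfold p
  gcongr <;> norm_num

theorem lt_p (n : ℕ) : 2 ^ 2 ^ n < p n := by
  unfold p
  exact Nat.pow_lt_pow_right (by norm_num)
    (Nat.lt_two_pow_self.trans (Nat.pow_lt_pow_right (by norm_num) Nat.lt_two_pow_self))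

theorem self_le_p (n : ℕ) : n ≤ p n :=
  (Nat.lt_two_pow_self.trans (Nat.lt_two_pow_self.trans (lt_p n))).le

theorem word_prefix {m n : ℕ} (h : m ≤ n) : word m <+: word n := by
  induction n, h using Nat.le_induction with
  | base => exact prefix_rfl
  | succ n _ ih => exact ih.trans (word_succ n ▸ ⟨_, (append_assoc _ _ _).symm⟩)

theorem word_suffix {m n : ℕ} (h : m ≤ n) : word m <:+ word n := by
  induction n, h using Nat.le_induction with
  | base => exact suffix_rfl
  | succ n _ ih => exact ih.trans (word_succ n ▸ suffix_append _ _)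

theorem isSubword_word (n : ℕ) : IsSubword (word n) := ⟨n, infix_rfl⟩

theorem IsSubword.of_infix {v w : List Letter} (hw : IsSubword w) (h : v <:+: w) : IsSubword v :=
  hw.imp fun _ => h.trans

theorem isSubword_nil : IsSubword [] := ⟨0, nil_infix⟩

/-- Any two subwords of the infinite word occur together in a longer one. -/
theorem IsSubword.exists_join {v w : List Letter} (hv : IsSubword v) (hw : IsSubword w) :
    ∃ u, IsSubword (v ++ u ++ w) := by
  obtain ⟨m, hm⟩ := hv
  obtain ⟨n, hn⟩ := hw
  obtain ⟨a, b, hab⟩ := hm.trans (word_prefix (le_max_left m n)).isInfix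
  obtain ⟨c, d, hcd⟩ := hn.trans (word_prefix (le_max_right m n)).isInfix
  refine ⟨b ++ ys (p (max m n + 1)) ++ c, max m n + 1, a, d, ?_⟩
  rw [word_succ]
  nth_rw 1 [← hab]
  rw [← hcd]
  simp

theorem count_word (n : ℕ) : (word n).count .x = 2 ^ n := by
  induction n with
  | zero => rfl
  | succ n ih =>
    rw [word_succ, count_append, count_append, ih, count_replicate, pow_succ]
    simp; ring

/-- The middle run of `y` dominates: `p` at least squares at each step, so `word n` is never longer
than `p (n + 1)`. -/
theorem length_word_succ_le (n : ℕ) : (word (n + 1)).length ≤ 3 * p (n + 1) := by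
  have key : (word n).length ≤ p (n + 1) := by
    induction n with
    | zero => exact (Nat.one_le_two_pow).trans (lt_p 1).le
    | succ n ih =>
      rw [word_succ, length_append, length_append, length_replicate]
      have h : 3 * p (n + 1) ≤ p (n + 1 + 1) := by
        have h1 : p (n + 1) * p (n + 1) ≤ p (n + 2) := by
          unfold p
          rw [← pow_add, ← two_mul, ← pow_succ']
          refine Nat.pow_le_pow_right (by norm_num) (Nat.pow_le_pow_right (by norm_num) ?_)
          exact Nat.pow_lt_pow_right (by norm_num) (Nat.pow_lt_pow_right (by norm_num) (by simp))
        have h2 : 3 ≤ p (n + 1) :=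
          le_trans (by norm_num) ((lt_p 1).le.trans (p_strictMono.monotone (by omega)))
        nlinarith
      omega
  rw [word_succ, length_append, length_append, length_replicate]
  omega

theorem exists_word_eq_cons (n : ℕ) : ∃ r, word n = .x :: r := by
  obtain ⟨r, hr⟩ := word_prefix (Nat.zero_le n)
  exact ⟨r, hr.symm⟩

theorem length_word_lt (n : ℕ) : n < (word n).length :=
  Nat.lt_two_pow_self.trans_le (count_word n ▸ count_le_length)

theorem infix_append_cases {α : Type*} {w a b : List α} (h : w <:+: a ++ b) :
    w <:+: a ∨ w <:+: b ∨ ∃ a' b', a' <:+ a ∧ b' <+: b ∧ w = a' ++ b' := by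
  obtain ⟨s, t, h⟩ := h
  rw [append_assoc, append_eq_append_iff] at h
  obtain ⟨c, h1, h2⟩ | ⟨c, h1, h2⟩ := h
  · rw [append_eq_append_iff] at h2
    obtain ⟨d, h3, h4⟩ | ⟨d, h3, h4⟩ := h2
    · exact .inl ⟨s, d, by rw [h1, h3, append_assoc]⟩
    · exact .inr (.inr ⟨c, d, ⟨s, h1.symm⟩, ⟨t, h4.symm⟩, h3⟩)
  · exact .inr (.inl ⟨c, t, by rw [h2, append_assoc]⟩)

theorem ys_append_ys_sub {k l : ℕ} (h : k ≤ l) : ys k ++ ys (l - k) = ys l := by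
  rw [replicate_append_replicate, Nat.add_sub_cancel' h]

theorem ys_sub_append_ys {k l : ℕ} (h : k ≤ l) : ys (l - k) ++ ys k = ys l := by
  rw [replicate_append_replicate, Nat.sub_add_cancel h]

theorem ys_infix_of_le {k l : ℕ} (h : k ≤ l) : ys k <:+: ys l :=
  ⟨[], ys (l - k), by rw [nil_append, ys_append_ys_sub h]⟩

/-- A subword either contains a long run of `y` or surrounds at most one short word. -/
theorem IsSubword.infix_cases {w : List Letter} (hw : IsSubword w) {j k : ℕ}
    (hk : k ≤ p (j + 1)) : ys k <:+: w ∨ w <:+: ys k ++ word j ++ ys k := by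
  obtain ⟨n, hn⟩ := hw
  have base : word j <:+: ys k ++ word j ++ ys k := infix_append _ _ _
  induction n generalizing w with
  | zero => exact .inr (hn.trans ((word_prefix (Nat.zero_le j)).isInfix.trans base))
  | succ n ih =>
    obtain hnj | hjn := Nat.lt_or_ge n j
    · exact .inr (hn.trans ((word_prefix hnj).isInfix.trans base))
    have hP : k ≤ p (n + 1) := hk.trans (p_strictMono.monotone (by omega))
    -- For `n > j` the word `word n` starts with `word (j + 1)`, hence with `word j ++ ys k`; a
    -- prefix either ends within that piece or contains its run of `y`.
    have hpre : ∀ b, b <+: word n → ys k <:+: b ∨ b <+: word j ++ ys k := fun b hb => by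
      obtain rfl | hlt := hjn.eq_or_lt
      · exact .inr (hb.trans (prefix_append _ _))
      · have h1 : word j ++ ys k <+: word n := by
          refine IsPrefix.trans ?_ (word_prefix hlt)
          rw [word_succ, append_assoc, prefix_append_right_inj]
          exact ⟨ys (p (j + 1) - k) ++ word j, by
            rw [← append_assoc, ys_append_ys_sub hk]⟩
        obtain h | h := prefix_or_prefix_of_prefix hb h1
        · exact .inr h
        · exact .inl ((suffix_append _ _).isInfix.trans h.isInfix)
    have hsuf : ∀ a, a <:+ word n → ys k <:+: a ∨ a <:+ ys k ++ word j := fun a ha => by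
      obtain rfl | hlt := hjn.eq_or_lt
      · exact .inr (ha.trans (suffix_append _ _))
      · have h1 : ys k ++ word j <:+ word n := by
          refine IsSuffix.trans ?_ (word_suffix hlt)
          rw [word_succ]
          exact ⟨word j ++ ys (p (j + 1) - k), by
            rw [append_assoc, ← append_assoc (ys _), ys_sub_append_ys hk, append_assoc]⟩
        obtain h | h := suffix_or_suffix_of_suffix ha h1
        · exact .inr h
        · exact .inl ((prefix_append _ _).isInfix.trans h.isInfix)
    have hys : ∀ i, ys i <:+ ys k ∨ ys k <:+: ys i := fun i => by
      obtain h | h := le_total i k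
      · exact .inl ⟨ys (k - i), ys_sub_append_ys h⟩
      · exact .inr (ys_infix_of_le h)
    have hys' : ∀ i, ys i <+: ys k ∨ ys k <:+: ys i := fun i => by
      obtain h | h := le_total i k
      · exact .inl ⟨ys (k - i), ys_append_ys_sub h⟩
      · exact .inr (ys_infix_of_le h)
    rw [word_succ] at hn
    obtain hn | hn | ⟨a, b, ha, hb, rfl⟩ := infix_append_cases hn
    · obtain hn | hn | ⟨a, b, ha, hb, rfl⟩ := infix_append_cases hn
      · exact ih hn
      · obtain ⟨i, rfl⟩ : ∃ i, w = ys i := ⟨_, (infix_replicate_iff.1 hn).2⟩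
        obtain h | h := hys i
        · exact .inr (h.isInfix.trans ⟨[], word j ++ ys k, by simp⟩)
        · exact .inl h
      · obtain ⟨i, rfl⟩ : ∃ i, b = ys i := ⟨_, (prefix_replicate_iff.1 hb).2⟩
        obtain h | h := hsuf a ha
        · exact .inl (h.trans (prefix_append _ _).isInfix)
        obtain h' | h' := hys' i
        · obtain ⟨s, hs⟩ := h
          obtain ⟨t, ht⟩ := h'
          refine .inr ⟨s, t, ?_⟩
          rw [← hs, ← ht]
          simp
        · exact .inl (h'.trans (suffix_append _ _).isInfix)
    · exact ih hn
    · obtain h | h := hpre b hb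
      · exact .inl (h.trans (suffix_append _ _).isInfix)
      -- The subword now reaches into the second copy of `word n`. If it also reaches back to the
      -- first copy, it contains the whole middle run.
      obtain h' | ⟨c, -, rfl⟩ : a <:+ ys (p (n + 1)) ∨
          ∃ c, c <:+ word n ∧ a = c ++ ys (p (n + 1)) := by
        obtain ⟨s, hs⟩ := ha
        rw [append_eq_append_iff] at hs
        obtain ⟨c, h1, h2⟩ | ⟨c, h1, h2⟩ := hs
        · exact .inr ⟨c, ⟨s, h1.symm⟩, h2⟩
        · exact .inl ⟨c, h2.symm⟩
      · obtain ⟨i, rfl⟩ : ∃ i, a = ys i := ⟨_, (suffix_replicate_iff.1 h').2⟩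
        obtain h' | h' := hys i
        · obtain ⟨s, hs⟩ := h'
          obtain ⟨t, ht⟩ := h
          refine .inr ⟨s, t, ?_⟩
          rw [append_assoc (ys k), ← ht, ← hs]
          simp
        · exact .inl (h'.trans (prefix_append _ _).isInfix)
      · exact .inl ((ys_infix_of_le hP).trans ⟨c, b, by simp⟩)

/-- A subword that is short compared with `p (j + 1)` sits inside one `word j`, up to powers
of `y` at its ends. -/
theorem IsSubword.infix_of_length_lt {w : List Letter} (hw : IsSubword w) {j k : ℕ}
    (hk : k ≤ p (j + 1)) (hl : w.length < k) : w <:+: ys k ++ word j ++ ys k := by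
  refine (hw.infix_cases hk).resolve_left fun h => ?_
  have := h.length_le
  simp at this
  omega

/-- The powers of `y` around `word j` contribute no `x`. This sparsity drives both the growth bound
and local nilpotence. -/
theorem IsSubword.count_le {w : List Letter} (hw : IsSubword w) {j : ℕ}
    (hl : w.length < p (j + 1)) : w.count .x ≤ 2 ^ j := by
  have := (hw.infix_of_length_lt le_rfl hl).sublist.count_le .x
  rw [count_append, count_append, count_word, count_replicate] at this
  simpa using this

/-- Arbitrarily long runs of `y` occur, each followed by a word that starts with `word n`. The lower
bound for the growth uses this. -/
theorem isSubword_ys_append_word (n k : ℕ) : IsSubword (ys k ++ word n) := by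
  refine ⟨max n k + 1, ?_⟩
  obtain ⟨s, hs⟩ := word_prefix (le_max_left n k)
  have h2 : k ≤ p (max n k + 1) := (by omega : k ≤ max n k + 1).trans (self_le_p _)
  refine ⟨word (max n k) ++ ys (p (max n k + 1) - k), s, ?_⟩
  rw [word_succ]
  nth_rw 3 [← hs]
  rw [← ys_sub_append_ys h2]
  simp only [append_assoc]

theorem isSubword_x : IsSubword [.x] := isSubword_word 0

/-- The words whose products are the `word n` without their first letter. -/
def block (i : ℕ) : List Letter := ys (p (i + 1)) ++ word i

theorem word_eq_blocks (n : ℕ) : word n = .x :: (range n).flatMap block := by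
  induction n with
  | zero => rfl
  | succ n ih =>
    rw [word_succ, range_succ, flatMap_append, flatMap_singleton, block, append_assoc]
    nth_rw 1 [ih]
    rfl

theorem isSubword_blocks (n : ℕ) : IsSubword ((range n).flatMap block) :=
  (isSubword_word n).of_infix (word_eq_blocks n ▸ (suffix_cons _ _).isInfix)

theorem ys_append_cons_inj {a b : ℕ} {r s : List Letter}
    (h : ys a ++ .x :: r = ys b ++ .x :: s) : a = b := by
  induction a generalizing b with
  | zero =>
    cases b with
    | zero => rfl
    | succ b => simp [ys, replicate_succ] at h
  | succ a ih =>
    cases b with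
    | zero => simp [ys, replicate_succ] at h
    | succ b =>
      simp only [ys, replicate_succ, cons_append, cons.injEq, true_and] at h
      rw [ih h]

/-- The blocks form a prefix code. -/
theorem flatMap_block_injective : Function.Injective fun l : List ℕ => l.flatMap block := by
  have hne : ∀ i r, block i ++ r ≠ [] := fun i r h => by
    obtain ⟨s, hs⟩ := exists_word_eq_cons i
    rw [block, hs] at h
    simp at h
  intro l l' h
  induction l generalizing l' with
  | nil =>
    cases l' with
    | nil => rfl
    | cons b l' => exact (hne b (l'.flatMap block) h.symm).elim
  | cons a l ih =>
    cases l' with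
    | nil => exact (hne a (l.flatMap block) h).elim
    | cons b l' =>
      simp only [flatMap_cons] at h
      -- The number of `y` before the first `x` is `p (a + 1)`, which determines `a`.
      have hab : a = b := by
        obtain ⟨r, hr⟩ := exists_word_eq_cons a
        obtain ⟨s, hs⟩ := exists_word_eq_cons b
        simp only [block, hr, hs, append_assoc, cons_append] at h
        have := p_strictMono.injective (ys_append_cons_inj h)
        omega
      subst hab
      rw [ih (append_cancel_left h)]

end WordCombinatorics

/-! ### Bases of the group algebra and of the subalgebra. -/

section Coefficients

open Pointwise

variable (K : Type u) [Field K]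

/-- The monoid of pairs of a word and a group element. -/
abbrev WordGroup : Type := FreeMonoid Letter × IrvingGroup

/-- The number of letters `x` in the word of a pair. -/
def xCount (q : WordGroup) : ℕ := q.1.toList.count .x

/-- The length of the word of a pair. -/
def wordLength (q : WordGroup) : ℕ := q.1.toList.length

theorem xCount_mul (q r : WordGroup) : xCount (q * r) = xCount q + xCount r :=
  List.count_append

theorem wordLength_mul (q r : WordGroup) : wordLength (q * r) = wordLength q + wordLength r :=
  List.length_append

/-- The element `w g` of `A[G]`, for a word `w` and a group element `g`. -/
def basisElem : WordGroup →* MonoidAlgebra (MonomialAlg K) IrvingGroup where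
  toFun q := MonoidAlgebra.single q.2 (toMonomialAlg K (monomial K q.1.toList))
  map_one' := by
    simp [monomial, MonoidAlgebra.one_def]
  map_mul' q r := by
    simp [monomial, MonoidAlgebra.single_mul_single]

/-- The map onto `A[G]` from the corresponding algebra without relations between words. -/
def toExample : MonoidAlgebra K WordGroup →ₐ[K] MonoidAlgebra (MonomialAlg K) IrvingGroup :=
  MonoidAlgebra.lift K _ _ (basisElem K)

theorem toExample_single (q : WordGroup) (c : K) :
    toExample K (MonoidAlgebra.single q c) = c • basisElem K q :=
  MonoidAlgebra.lift_single _ _ _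

theorem basisElem_eq_zero {q : WordGroup} (h : ¬ IsSubword q.1.toList) : basisElem K q = 0 := by
  have : toMonomialAlg K (monomial K q.1.toList) = 0 := by
    rw [← map_zero (toMonomialAlg K)]
    exact RingQuot.mkAlgHom_rel K (MonomialRel.zero _ h)
  change MonoidAlgebra.single q.2 _ = 0
  rw [this, MonoidAlgebra.single_zero]

open scoped Classical in
/-- A letter acts on words by prolongation, as long as the result is a subword. -/
def letterAct (a : Letter) : (List Letter →₀ K) →ₗ[K] (List Letter →₀ K) :=
  Finsupp.linearCombination K fun w => if IsSubword (a :: w) then Finsupp.single (a :: w) 1 else 0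

-- Since subwords are closed under taking factors, prolonging letter by letter survives exactly when
-- the final word is a subword. The case `w = []` is separate: the identity fixes `u` even if `u` is
-- not a subword. Applied to the empty word, this action separates the subwords and supplies
-- coordinates on `A[G]`.
open scoped Classical in
theorem lift_letterAct_monomial (w u : List Letter) :
    FreeAlgebra.lift K (letterAct K) (monomial K w) (Finsupp.single u 1) =
      if IsSubword (w ++ u) ∨ w = [] then Finsupp.single (w ++ u) 1 else 0 := by
  induction w with
  | nil => simp [monomial]
  | cons a w ih =>
    have h : monomial K (a :: w) = FreeAlgebra.ι K a * monomial K w := by simp [monomial]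
    rw [h, map_mul, Module.End.mul_apply, ih, FreeAlgebra.lift_ι_apply]
    split_ifs with h1 h2 h2
    · simp only [letterAct, Finsupp.linearCombination_single, one_smul]
      simp only [or_false, List.cons_append] at h2
      rw [if_pos h2, List.cons_append]
    · simp only [letterAct, Finsupp.linearCombination_single, one_smul]
      simp only [or_false, List.cons_append] at h2
      rw [if_neg h2]
    · exfalso
      simp only [or_false, List.cons_append] at h2
      exact h1 (.inl (h2.of_infix (List.suffix_cons _ _).isInfix))
    · simp

/-- The action of the monomial algebra on the span of the words. -/
def monomialAct : MonomialAlg K →ₐ[K] Module.End K (List Letter →₀ K) :=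
  RingQuot.liftAlgHom K ⟨FreeAlgebra.lift K (letterAct K), by
    rintro _ _ ⟨w, hw⟩
    rw [map_zero]
    refine Finsupp.lhom_ext fun u c => ?_
    rw [← mul_one c, ← smul_eq_mul, ← Finsupp.smul_single, map_smul, lift_letterAct_monomial,
      if_neg, smul_zero, LinearMap.zero_apply]
    rintro (h | rfl)
    · exact hw (h.of_infix (List.prefix_append _ _).isInfix)
    · exact hw isSubword_nil⟩

/-- The coordinate of an element of `A[G]` at a pair of a subword and a group element. -/
def coord (q : WordGroup) : MonoidAlgebra (MonomialAlg K) IrvingGroup →ₗ[K] K where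
  toFun b := monomialAct K (b.coeff q.2) (Finsupp.single [] 1) q.1.toList
  map_add' b c := by simp
  map_smul' c b := by simp

open scoped Classical in
theorem coord_basisElem (q r : WordGroup) :
    coord K q (basisElem K r) = if IsSubword r.1.toList ∧ r = q then 1 else 0 := by
  have h : monomialAct K (toMonomialAlg K (monomial K r.1.toList)) =
      FreeAlgebra.lift K (letterAct K) (monomial K r.1.toList) :=
    RingQuot.liftAlgHom_mkAlgHom_apply K _ _ _
  simp only [coord, LinearMap.coe_mk, AddHom.coe_mk]
  change monomialAct K ((MonoidAlgebra.single r.2 _).coeff q.2) _ _ = _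
  rw [MonoidAlgebra.coeff_single, Finsupp.single_apply]
  by_cases h2 : r.2 = q.2
  · rw [if_pos h2, h, lift_letterAct_monomial, List.append_nil]
    by_cases h1 : IsSubword r.1.toList
    · rw [if_pos (.inl h1), Finsupp.single_apply]
      refine if_congr ?_ rfl rfl
      rw [Prod.ext_iff]
      exact ⟨fun h => ⟨h1, FreeMonoid.toList.injective h, h2⟩, fun h => by rw [h.2.1]⟩
    · rw [if_neg, if_neg (fun h => h1 h.1), Finsupp.zero_apply]
      rintro (h | h)
      · exact h1 h
      · exact h1 (h ▸ isSubword_nil)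
  · rw [if_neg h2, if_neg (fun h => h2 (by rw [h.2])), map_zero, LinearMap.zero_apply,
      Finsupp.zero_apply]

theorem coord_toExample {q : WordGroup} (hq : IsSubword q.1.toList)
    (f : MonoidAlgebra K WordGroup) :
    coord K q (toExample K f) = f.coeff q := by
  classical
  induction f using MonoidAlgebra.induction_linear with
  | zero => simp
  | add f g hf hg => simp [hf, hg]
  | single r c =>
    rw [toExample_single, map_smul, coord_basisElem, MonoidAlgebra.coeff_single,
      Finsupp.single_apply, smul_eq_mul]
    by_cases h : r = q
    · simp [h, hq]
    · simp [h]

/-- The pairs `(w, g)` with `g` a product of as many group generators as `w` has letters `x`. -/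
def admissible : Submonoid WordGroup where
  carrier := {q | q.2 ∈ groupGens ^ xCount q}
  one_mem' := Set.one_mem_one
  mul_mem' {q r} hq hr := by
    change (q * r).2 ∈ groupGens ^ xCount (q * r)
    rw [xCount_mul]
    exact mul_mem_ball hq hr

theorem mem_admissible {q : WordGroup} : q ∈ admissible ↔ q.2 ∈ groupGens ^ xCount q := Iff.rfl

theorem basisElem_of_letter (a : Letter) (g : IrvingGroup) :
    basisElem K (FreeMonoid.of a, g) = mono K a g := by
  simp [basisElem, mono, letter, monomial]

theorem generators_eq : generators K =
    basisElem K '' ({q | q.1 = FreeMonoid.of .x ∧ q.2 ∈ groupGens} ∪ {(FreeMonoid.of .y, 1)}) := by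
  ext b
  simp only [generators, groupGens, Set.mem_insert_iff, Set.mem_singleton_iff, Set.mem_image,
    Set.mem_union, Set.mem_ofPred_eq, Prod.exists, Prod.mk.injEq, ← basisElem_of_letter]
  constructor
  · rintro (h | h | h | h | h | h | h | h)
    all_goals exact ⟨_, _, by tauto, h.symm⟩
  · rintro ⟨w, g, ⟨rfl, h⟩ | ⟨rfl, rfl⟩, rfl⟩
    · rcases h with rfl | rfl | rfl | rfl | rfl | rfl | rfl <;> simp
    · simp

/-- Only the product of the group generators carried by the letters `x` matters. As `1` is among the
allowed factors, a word with `k` letters `x` carries every element of `groupGens ^ k`. -/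
theorem closure_generators :
    Submonoid.closure (generators K) = admissible.map (basisElem K) := by
  apply le_antisymm
  · rw [Submonoid.closure_le, generators_eq]
    rintro _ ⟨⟨w, g⟩, ⟨rfl, hg⟩ | h, rfl⟩
    · exact ⟨_, by simpa [mem_admissible, xCount] using hg, rfl⟩
    · obtain ⟨rfl, rfl⟩ := Prod.mk.injEq .. ▸ (Set.mem_singleton_iff.1 h)
      exact ⟨_, by simp [mem_admissible, xCount], rfl⟩
  · have hx : ∀ s ∈ groupGens, basisElem K (FreeMonoid.of .x, s) ∈
        Submonoid.closure (generators K) := fun s hs => by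
      rw [generators_eq]
      exact Submonoid.subset_closure ⟨_, .inl ⟨rfl, hs⟩, rfl⟩
    have hy : basisElem K (FreeMonoid.of .y, 1) ∈ Submonoid.closure (generators K) := by
      rw [generators_eq]
      exact Submonoid.subset_closure ⟨_, .inr rfl, rfl⟩
    rintro _ ⟨⟨w, g⟩, hq, rfl⟩
    replace hq : g ∈ groupGens ^ xCount (w, g) := hq
    induction w using FreeMonoid.inductionOn' generalizing g with
    | one =>
      obtain rfl : g = 1 := by simpa [xCount] using hq
      exact (basisElem K).map_one ▸ Submonoid.one_mem _
    | of_mul a w ih =>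
      cases a with
      | x =>
        have h : xCount (FreeMonoid.of .x * w, g) = xCount (w, g) + 1 := by simp [xCount]
        rw [h, pow_succ'] at hq
        obtain ⟨s, hs, g', hg', rfl⟩ := hq
        have := Submonoid.mul_mem _ (hx s hs) (ih g' hg')
        rwa [← map_mul] at this
      | y =>
        have h : xCount (FreeMonoid.of .y * w, g) = xCount (w, g) := by simp [xCount]
        rw [h] at hq
        have := Submonoid.mul_mem _ hy (ih g hq)
        rwa [← map_mul, Prod.mk_mul_mk, one_mul] at this

theorem exampleAlg_eq_span :
    (exampleAlg K).toSubmodule = Submodule.span K (basisElem K '' admissible) := by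
  rw [exampleAlg, Algebra.adjoin_eq_span, closure_generators]
  rfl

theorem basisElem_mem {q : WordGroup} (hq : q ∈ admissible) : basisElem K q ∈ exampleAlg K := by
  rw [← Subalgebra.mem_toSubmodule, exampleAlg_eq_span]
  exact Submodule.subset_span ⟨q, hq, rfl⟩

/-- The pairs that give the elements of a basis of the subalgebra. -/
def basisSet : Set WordGroup := {q | IsSubword q.1.toList ∧ q ∈ admissible}

theorem exists_toExample_of_mem_span {P : Set WordGroup}
    {b : MonoidAlgebra (MonomialAlg K) IrvingGroup}
    (hb : b ∈ Submodule.span K (basisElem K '' P)) :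
    ∃ f : MonoidAlgebra K WordGroup,
      (∀ q ∈ f.coeff.support, IsSubword q.1.toList ∧ q ∈ P) ∧ toExample K f = b := by
  classical
  induction hb using Submodule.span_induction with
  | mem b hb =>
    obtain ⟨q, hq, rfl⟩ := hb
    by_cases h : IsSubword q.1.toList
    · refine ⟨MonoidAlgebra.single q 1, fun r hr => ?_, by simp [toExample_single]⟩
      rw [MonoidAlgebra.coeff_single] at hr
      obtain rfl := Finset.mem_singleton.1 (Finsupp.support_single_subset hr)
      exact ⟨h, hq⟩
    · exact ⟨0, by simp, by rw [map_zero, basisElem_eq_zero K h]⟩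
  | zero => exact ⟨0, by simp, map_zero _⟩
  | add b c _ _ hb hc =>
    obtain ⟨f, hf, rfl⟩ := hb
    obtain ⟨g, hg, rfl⟩ := hc
    refine ⟨f + g, fun r hr => ?_, map_add _ _ _⟩
    rw [MonoidAlgebra.coeff_add] at hr
    exact (Finset.mem_union.1 (Finsupp.support_add hr)).elim (hf r) (hg r)
  | smul c b _ hb =>
    obtain ⟨f, hf, rfl⟩ := hb
    refine ⟨c • f, fun r hr => hf r ?_, map_smul _ _ _⟩
    rw [MonoidAlgebra.coeff_smul] at hr
    exact Finsupp.support_smul hr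

theorem toExample_mem_span {P : Set WordGroup} {f : MonoidAlgebra K WordGroup}
    (hf : ∀ q ∈ f.coeff.support, q ∈ P) :
    toExample K f ∈ Submodule.span K (basisElem K '' P) := by
  rw [toExample, MonoidAlgebra.lift_apply]
  exact Submodule.sum_mem _ fun q hq =>
    Submodule.smul_mem _ _ (Submodule.subset_span ⟨q, hf q hq, rfl⟩)

theorem exists_toExample (b : exampleAlg K) :
    ∃ f : MonoidAlgebra K WordGroup,
      (∀ q ∈ f.coeff.support, q ∈ basisSet) ∧ toExample K f = b.1 := by
  have := b.2
  rw [← Subalgebra.mem_toSubmodule, exampleAlg_eq_span] at this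
  exact exists_toExample_of_mem_span K this

theorem toExample_ne_zero {q : WordGroup} (hq : IsSubword q.1.toList)
    {f : MonoidAlgebra K WordGroup} (hf : f.coeff q ≠ 0) : toExample K f ≠ 0 := fun h => by
  rw [← coord_toExample K hq, h, map_zero] at hf
  exact hf rfl

end Coefficients

section Structure

open Pointwise

variable (K : Type u) [Field K]

theorem mul_mem_span_basisElem {P Q R : Set WordGroup}
    (h : ∀ q ∈ P, ∀ r ∈ Q, q * r ∈ R) {b c : MonoidAlgebra (MonomialAlg K) IrvingGroup}
    (hb : b ∈ Submodule.span K (basisElem K '' P)) (hc : c ∈ Submodule.span K (basisElem K '' Q)) :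
    b * c ∈ Submodule.span K (basisElem K '' R) := by
  have := Submodule.mul_mem_mul hb hc
  rw [Submodule.span_mul_span] at this
  refine Submodule.span_mono ?_ this
  rintro _ ⟨_, ⟨q, hq, rfl⟩, _, ⟨r, hr, rfl⟩, rfl⟩
  exact ⟨q * r, h q hq r hr, map_mul _ _ _⟩

theorem mem_span_admissible (b : exampleAlg K) :
    b.1 ∈ Submodule.span K (basisElem K '' admissible) := by
  rw [← exampleAlg_eq_span]
  exact b.2

theorem eq_zero_of_coord {b : exampleAlg K}
    (h : ∀ q : WordGroup, IsSubword q.1.toList → coord K q b.1 = 0) : b = 0 := by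
  obtain ⟨f, hf, hfb⟩ := exists_toExample K b
  have : f = 0 := by
    ext q
    by_contra hq
    have hs := (hf q (Finsupp.mem_support_iff.2 hq)).1
    exact hq (by rw [← coord_toExample K hs, hfb, h q hs]; rfl)
  apply Subtype.ext
  rw [← hfb, this, map_zero]
  rfl

/-- The elements of the subalgebra that are combinations of basis elements from a set of pairs. -/
def spanOf (P : Set WordGroup) : Submodule K (exampleAlg K) :=
  (Submodule.span K (basisElem K '' P)).comap (exampleAlg K).val.toLinearMap

theorem mul_mem_spanOf {P Q R : Set WordGroup} (h : ∀ q ∈ P, ∀ r ∈ Q, q * r ∈ R)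
    {b c : exampleAlg K} (hb : b ∈ spanOf K P) (hc : c ∈ spanOf K Q) : b * c ∈ spanOf K R :=
  mul_mem_span_basisElem K h hb hc

theorem finiteType_exampleAlg : Algebra.FiniteType K (exampleAlg K) := by
  have h : (generators K).Finite := by simp [generators]
  rw [← Subalgebra.fg_iff_finiteType]
  obtain ⟨s, hs⟩ := h.exists_finset_coe
  exact ⟨s, by rw [hs]; rfl⟩

/-! ### Primeness. -/

section Prime

/-- In a product of two nonzero elements some coefficient is the product of two nonzero
coefficients, whatever word is put between them. -/
theorem exists_coeff_mul_single_mul {f h : MonoidAlgebra K WordGroup} (hf : f ≠ 0) (hh : h ≠ 0) :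
    ∃ q ∈ f.coeff.support, ∃ r ∈ h.coeff.support, ∀ u : FreeMonoid Letter,
      (f * MonoidAlgebra.single (u, 1) 1 * h).coeff (q * (u, 1) * r) ≠ 0 := by
  classical
  have hf' : f.coeff.support.Nonempty := by
    rw [Finsupp.support_nonempty_iff]
    exact fun h0 => hf (MonoidAlgebra.coeff_injective h0)
  have hh' : h.coeff.support.Nonempty := by
    rw [Finsupp.support_nonempty_iff]
    exact fun h0 => hh (MonoidAlgebra.coeff_injective h0)
  obtain ⟨q₀, hq₀, hqmax⟩ := Finset.exists_max_image _ wordLength hf'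
  obtain ⟨r₀, hr₀, hrmax⟩ := Finset.exists_max_image _ wordLength hh'
  -- Two words of maximal length are fixed, and a unique product is taken among the group elements
  -- attached to them. In any competing factorisation neither word is longer, so equality of the
  -- total length forces the same cut, and hence the same words.
  obtain ⟨a, ha, b, hb, hab⟩ := UniqueProds.uniqueMul_of_nonempty
    (A := ({q ∈ f.coeff.support | q.1 = q₀.1}).image Prod.snd)
    (B := ({r ∈ h.coeff.support | r.1 = r₀.1}).image Prod.snd)
    ⟨_, Finset.mem_image_of_mem _ (Finset.mem_filter.2 ⟨hq₀, rfl⟩)⟩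
    ⟨_, Finset.mem_image_of_mem _ (Finset.mem_filter.2 ⟨hr₀, rfl⟩)⟩
  obtain ⟨q, hq, rfl⟩ := Finset.mem_image.1 ha
  obtain ⟨r, hr, rfl⟩ := Finset.mem_image.1 hb
  rw [Finset.mem_filter] at hq hr
  refine ⟨q, hq.1, r, hr.1, fun u => ?_⟩
  have hu : UniqueMul (f * MonoidAlgebra.single (u, 1) 1).coeff.support h.coeff.support
      (q * (u, 1)) r := by
    intro q' r' hq' hr' heq
    obtain ⟨q', hq'', rfl⟩ :=
      Finset.mem_image.1 (MonoidAlgebra.support_coeff_mul_single_subset _ _ _ hq')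
    have h1 := congrArg (fun z => z.1.toList) heq
    have h2 := congrArg Prod.snd heq
    simp only [Prod.fst_mul, Prod.snd_mul, mul_one, FreeMonoid.toList_mul, List.append_assoc]
      at h1 h2
    have l1 : q'.1.toList.length ≤ q.1.toList.length := by
      rw [hq.2]; exact hqmax _ hq''
    have l2 : r'.1.toList.length ≤ r.1.toList.length := by
      rw [hr.2]; exact hrmax _ hr'
    have l3 := congrArg List.length h1
    simp only [List.length_append] at l3
    obtain ⟨e1, e2⟩ := List.append_inj h1 (by omega)
    replace e1 : q'.1 = q.1 := FreeMonoid.toList.injective e1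
    replace e2 : r'.1 = r.1 := FreeMonoid.toList.injective (List.append_cancel_left e2)
    obtain ⟨e3, e4⟩ := hab
      (Finset.mem_image_of_mem _ (Finset.mem_filter.2 ⟨hq'', e1.trans hq.2⟩))
      (Finset.mem_image_of_mem _ (Finset.mem_filter.2 ⟨hr', e2.trans hr.2⟩)) h2
    rw [Prod.ext e1 e3, Prod.ext e2 e4]
    exact ⟨rfl, rfl⟩
  rw [MonoidAlgebra.coeff_mul_mul_of_uniqueMul hu, MonoidAlgebra.coeff_mul_single_mul, mul_one]
  exact mul_ne_zero (Finsupp.mem_support_iff.1 hq.1) (Finsupp.mem_support_iff.1 hr.1)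

theorem word_mem_admissible (w : FreeMonoid Letter) : (w, (1 : IrvingGroup)) ∈ admissible :=
  ball_mono (Nat.zero_le _) (by simp)

/-- A word as an element of the subalgebra. -/
def wordElem (w : List Letter) : exampleAlg K :=
  ⟨basisElem K (FreeMonoid.ofList w, 1), basisElem_mem K (word_mem_admissible _)⟩

theorem wordElem_ne_zero {w : List Letter} (hw : IsSubword w) : wordElem K w ≠ 0 := fun h => by
  refine toExample_ne_zero K (q := (FreeMonoid.ofList w, 1)) hw
    (f := MonoidAlgebra.single (FreeMonoid.ofList w, 1) 1) (by simp) ?_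
  rw [toExample_single, one_smul]
  exact congrArg Subtype.val h

/-- The two surviving terms do not depend on the word put between them, so that word can be chosen
afterwards to join their words into a subword, whose coefficient is visible in `A[G]`. -/
instance isPrimeRing_exampleAlg : IsPrimeRing (exampleAlg K) where
  exists_pair_ne := ⟨_, _, wordElem_ne_zero K isSubword_nil⟩
  eq_zero_or a b hab := by
    by_contra! hne
    obtain ⟨f, hf, hfa⟩ := exists_toExample K a
    obtain ⟨h, hh, hhb⟩ := exists_toExample K b
    have hf0 : f ≠ 0 := fun h0 => hne.1 (Subtype.ext (by rw [← hfa, h0, map_zero]; rfl))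
    have hh0 : h ≠ 0 := fun h0 => hne.2 (Subtype.ext (by rw [← hhb, h0, map_zero]; rfl))
    obtain ⟨q, hq, r, hr, hqr⟩ := exists_coeff_mul_single_mul K hf0 hh0
    obtain ⟨u, hu⟩ := (hf q hq).1.exists_join (hh r hr).1
    have hu' : IsSubword (q * ((FreeMonoid.ofList u, 1) : WordGroup) * r).1.toList := hu
    refine toExample_ne_zero K hu' (hqr _) ?_
    rw [map_mul, map_mul, hfa, hhb, toExample_single, one_smul]
    exact congrArg Subtype.val (hab (wordElem K u))

end Prime

/-! ### Local nilpotence of the ideal generated by `x`. -/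

section LocallyNilpotent

/-- The two-sided ideal of the elements of the subalgebra that are combinations of basis elements
from a given set of pairs. -/
def idealOf (P : Set WordGroup) (hl : ∀ q ∈ admissible, ∀ r ∈ P, q * r ∈ P)
    (hr : ∀ q ∈ P, ∀ r ∈ admissible, q * r ∈ P) : TwoSidedIdeal (exampleAlg K) :=
  TwoSidedIdeal.mk' (spanOf K P) (spanOf K P).zero_mem (spanOf K P).add_mem (spanOf K P).neg_mem
    (fun {b _} hc => mul_mem_spanOf K hl (mem_span_admissible K b) hc)
    (fun {_ c} hb => mul_mem_spanOf K hr hb (mem_span_admissible K c))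

theorem mem_idealOf {P : Set WordGroup} {hl : ∀ q ∈ admissible, ∀ r ∈ P, q * r ∈ P}
    {hr : ∀ q ∈ P, ∀ r ∈ admissible, q * r ∈ P} {b : exampleAlg K} :
    b ∈ idealOf K P hl hr ↔ b.1 ∈ Submodule.span K (basisElem K '' P) := by
  unfold idealOf
  rw [TwoSidedIdeal.mem_mk']
  exact Iff.rfl

theorem exampleX_eq : exampleX K = wordElem K [.x] :=
  Subtype.ext (basisElem_of_letter K .x 1).symm

theorem span_exampleX_ne_bot : TwoSidedIdeal.span {exampleX K} ≠ ⊥ :=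
  ne_bot_of_mem (TwoSidedIdeal.subset_span rfl)
    (exampleX_eq K ▸ wordElem_ne_zero K isSubword_x)

theorem mem_span_of_mem_span_exampleX {b : exampleAlg K}
    (hb : b ∈ TwoSidedIdeal.span {exampleX K}) :
    b.1 ∈ Submodule.span K (basisElem K '' {q | 1 ≤ xCount q}) := by
  have : TwoSidedIdeal.span {exampleX K} ≤ idealOf K {q | 1 ≤ xCount q}
      (fun q _ r (hr : 1 ≤ _) => by
        change 1 ≤ _
        rw [xCount_mul]; omega)
      (fun q (hq : 1 ≤ _) r _ => by
        change 1 ≤ _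
        rw [xCount_mul]; omega) := by
    rw [TwoSidedIdeal.span_le, Set.singleton_subset_iff, SetLike.mem_coe, mem_idealOf, exampleX_eq]
    exact Submodule.subset_span ⟨(FreeMonoid.ofList [.x], 1), by simp [xCount], rfl⟩
  exact (mem_idealOf K).1 (this hb)

theorem exists_wordLength_le {P : Set WordGroup} {b : MonoidAlgebra (MonomialAlg K) IrvingGroup}
    (hb : b ∈ Submodule.span K (basisElem K '' P)) :
    ∃ N, ∀ n, N ≤ n →
      b ∈ Submodule.span K (basisElem K '' {q | q ∈ P ∧ wordLength q ≤ n}) := by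
  obtain ⟨f, hf, rfl⟩ := exists_toExample_of_mem_span K hb
  exact ⟨f.coeff.support.sup wordLength, fun n hn => toExample_mem_span K fun q hq =>
    ⟨(hf q hq).2, (Finset.le_sup hq).trans hn⟩⟩

theorem exists_two_pow_add_one_mul_lt (L : ℕ) : ∃ j, (2 ^ j + 1) * L < p (j + 1) := by
  refine ⟨L, lt_of_le_of_lt ?_ (lt_p (L + 1))⟩
  calc (2 ^ L + 1) * L ≤ 2 ^ (L + 1) * 2 ^ L := by
        gcongr
        · rw [pow_succ]
          have := Nat.one_le_two_pow (n := L)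
          omega
        · exact Nat.lt_two_pow_self.le
    _ = 2 ^ (L + 1 + L) := (pow_add _ _ _).symm
    _ ≤ 2 ^ 2 ^ (L + 1) := Nat.pow_le_pow_right (by norm_num) (by
        have := Nat.lt_two_pow_self (n := L)
        rw [pow_succ]; omega)

/-- If all words involved have length at most `L`, a product of `2 ^ j + 1` elements involves only
words with more than `2 ^ j` letters `x` and length at most `(2 ^ j + 1) * L`. When this is below `p
(j + 1)`, no such word is a subword. -/
theorem isLocallyNilpotent_span_exampleX :
    IsLocallyNilpotent (TwoSidedIdeal.span {exampleX K}) := by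
  intro S hS
  have h1 : ∀ a : exampleAlg K, ∃ N, a ∈ S → ∀ n, N ≤ n → a.1 ∈ Submodule.span K
      (basisElem K '' {q | 1 ≤ xCount q ∧ wordLength q ≤ n}) := fun a => by
    by_cases ha : a ∈ S
    · exact (exists_wordLength_le K (mem_span_of_mem_span_exampleX K (hS a ha))).imp
        fun _ h _ => h
    · exact ⟨0, fun h => absurd h ha⟩
  choose N hN using h1
  set L := S.sup N with hL
  have h2 : ∀ l : List (exampleAlg K), (∀ a ∈ l, a ∈ S) → l.prod.1 ∈ Submodule.span K
      (basisElem K '' {q | l.length ≤ xCount q ∧ wordLength q ≤ l.length * L}) := by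
    intro l hl
    induction l with
    | nil =>
      exact Submodule.subset_span ⟨1, ⟨Nat.zero_le _, by simp [wordLength]⟩, map_one _⟩
    | cons a l ih =>
      rw [List.prod_cons]
      refine mul_mem_span_basisElem K (fun q hq r hr => ?_)
        (hN a (hl a (by simp)) L (Finset.le_sup (hl a (by simp))))
        (ih fun b hb => hl b (by simp [hb]))
      obtain ⟨hq1, hq2⟩ := hq
      obtain ⟨hr1, hr2⟩ := hr
      refine ⟨?_, ?_⟩
      · rw [xCount_mul, List.length_cons]; omega
      · rw [wordLength_mul, List.length_cons, add_mul]; omega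
  obtain ⟨j, hj⟩ := exists_two_pow_add_one_mul_lt L
  refine ⟨2 ^ j + 1, fun l hl hlS => Subtype.ext ?_⟩
  have h3 := h2 l hlS
  rw [hl] at h3
  suffices h : basisElem K '' {q | 2 ^ j + 1 ≤ xCount q ∧ wordLength q ≤ (2 ^ j + 1) * L} ⊆ {0} by
    have := Submodule.span_mono (R := K) h h3
    rwa [Submodule.span_zero_singleton, Submodule.mem_bot] at this
  rintro _ ⟨q, ⟨hq1, hq2⟩, rfl⟩
  refine basisElem_eq_zero K fun hq => ?_
  have := hq.count_le (j := j) (lt_of_le_of_lt hq2 hj)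
  exact absurd (hq1.trans this) (by omega)

end LocallyNilpotent

/-! ### The grading by word length. -/

section Grading

/-- The homogeneous component of degree `n`, spanned by the basis elements with a word of
length `n`. -/
def component (n : ℕ) : Submodule K (exampleAlg K) :=
  spanOf K {q | q ∈ admissible ∧ wordLength q = n}

theorem mem_component {n : ℕ} {b : exampleAlg K} : b ∈ component K n ↔
    b.1 ∈ Submodule.span K (basisElem K '' {q | q ∈ admissible ∧ wordLength q = n}) := Iff.rfl

theorem coord_eq_zero_of_mem_component {n : ℕ} {b : exampleAlg K} (hb : b ∈ component K n)
    {q : WordGroup} (hq : wordLength q ≠ n) : coord K q b.1 = 0 := by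
  have : Submodule.span K (basisElem K '' {q | q ∈ admissible ∧ wordLength q = n}) ≤
      LinearMap.ker (coord K q) := by
    rw [Submodule.span_le]
    rintro _ ⟨r, ⟨-, hr⟩, rfl⟩
    rw [SetLike.mem_coe, LinearMap.mem_ker, coord_basisElem, if_neg]
    rintro ⟨-, rfl⟩
    exact hq hr
  exact this hb

theorem isInternal_component : DirectSum.IsInternal (component K) := by
  rw [DirectSum.isInternal_submodule_iff_iSupIndep_and_iSup_eq_top]
  constructor
  · intro n
    rw [Submodule.disjoint_def]
    intro b hb hb'
    refine eq_zero_of_coord K fun q _ => ?_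
    by_cases hqn : wordLength q = n
    · have : ⨆ (m) (_ : m ≠ n), component K m ≤
          LinearMap.ker ((coord K q).comp (exampleAlg K).val.toLinearMap) :=
        iSup₂_le fun m hm c hc => coord_eq_zero_of_mem_component K hc (hqn.trans_ne hm.symm)
      exact this hb'
    · exact coord_eq_zero_of_mem_component K hb hqn
  · rw [eq_top_iff]
    rintro b -
    have key : ∀ c ∈ Submodule.span K (basisElem K '' admissible),
        c ∈ (⨆ n, component K n).map (exampleAlg K).val.toLinearMap := by
      refine fun c hc => (Submodule.span_le.2 ?_ : _ ≤ _) hc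
      rintro _ ⟨q, hq, rfl⟩
      exact ⟨⟨_, basisElem_mem K hq⟩, Submodule.mem_iSup_of_mem (wordLength q)
        ((mem_component K).2 (Submodule.subset_span ⟨q, ⟨hq, rfl⟩, rfl⟩)), rfl⟩
    obtain ⟨c, hc, hcb⟩ := key b.1 (mem_span_admissible K b)
    rwa [← (Subtype.ext hcb : c = b)]

theorem gradedMonoid_component : SetLike.GradedMonoid (component K) where
  one_mem := (mem_component K).2
    (Submodule.subset_span ⟨1, ⟨one_mem admissible, rfl⟩, map_one (basisElem K)⟩)
  mul_mem m n _ _ hb hc :=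
    mul_mem_spanOf K (R := {q | q ∈ admissible ∧ wordLength q = m + n})
      (fun q hq r hr => ⟨mul_mem hq.1 hr.1, by rw [wordLength_mul, hq.2, hr.2]⟩) hb hc

theorem exists_grading : ∃ 𝒜 : ℕ → Submodule K (exampleAlg K), Nonempty (GradedAlgebra 𝒜) ∧
    ∀ b : exampleAlg K, b.1 ∈ generators K → b ∈ 𝒜 1 := by
  refine ⟨component K, ⟨{
    toGradedMonoid := gradedMonoid_component K
    toDecomposition := (isInternal_component K).chooseDecomposition (component K) }⟩,
    fun b hb => ?_⟩
  rw [generators_eq] at hb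
  rw [mem_component]
  obtain ⟨⟨w, g⟩, hwg, hb⟩ := hb
  obtain ⟨rfl, hg⟩ | h := hwg
  · rw [← hb]
    exact Submodule.subset_span ⟨_, ⟨by simpa [mem_admissible, xCount] using hg, rfl⟩, rfl⟩
  · rw [← hb, Set.mem_singleton_iff.1 h]
    exact Submodule.subset_span ⟨_, ⟨word_mem_admissible _, rfl⟩, rfl⟩

end Grading

/-! ### Absence of polynomial identities. -/

section PolynomialIdentities

/-- The sum of the free generators with index below `d` that a map `g` sends to `n`. -/
def fibreSum (g : ℕ → ℕ) (d n : ℕ) : MonoidAlgebra K (FreeMonoid ℕ) :=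
  ∑ j ∈ Finset.range d with g j = n, MonoidAlgebra.single (FreeMonoid.of j) 1

open scoped Classical in
theorem coeff_prod_fibreSum (g : ℕ → ℕ) (d : ℕ) (m l : List ℕ) :
    (m.map (fibreSum K g d)).prod.coeff (FreeMonoid.ofList l) =
      if l.map g = m ∧ ∀ j ∈ l, j < d then 1 else 0 := by
  induction m generalizing l with
  | nil =>
    rw [List.map_nil, List.prod_nil, MonoidAlgebra.one_def, MonoidAlgebra.coeff_single,
      Finsupp.single_apply]
    cases l with
    | nil => simp
    | cons i l =>
      exact (if_neg (fun h => by simpa using congrArg FreeMonoid.toList h)).trans (by simp)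
  | cons a m ih =>
    rw [List.map_cons, List.prod_cons, fibreSum, Finset.sum_mul, MonoidAlgebra.coeff_sum,
      Finsupp.finsetSum_apply]
    cases l with
    | nil =>
      rw [if_neg (by simp)]
      refine Finset.sum_eq_zero fun j _ => MonoidAlgebra.coeff_single_mul_of_forall_mul_ne _ _ ?_
      intro e he
      exact absurd (congrArg FreeMonoid.toList he) (by simp)
    | cons i l =>
      have key : ∀ j, (MonoidAlgebra.single (FreeMonoid.of j) (1 : K) *
          (m.map (fibreSum K g d)).prod).coeff (FreeMonoid.ofList (i :: l)) =
          if i = j then (m.map (fibreSum K g d)).prod.coeff (FreeMonoid.ofList l) else 0 := by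
        intro j
        split_ifs with hij
        · rw [FreeMonoid.ofList_cons, hij, MonoidAlgebra.coeff_single_mul_mul, one_mul]
        · refine MonoidAlgebra.coeff_single_mul_of_forall_mul_ne _ _ fun e he => ?_
          have := congrArg FreeMonoid.toList he
          simp at this
          exact hij this.1.symm
      simp_rw [key]
      rw [Finset.sum_ite_eq, ih, ← ite_and]
      refine if_congr ?_ rfl rfl
      simp only [Finset.mem_filter, Finset.mem_range, List.map_cons, List.cons.injEq,
        List.forall_mem_cons]
      tauto

/-- The homomorphism from the free monoid that sends the generators to the blocks. -/
def blockHom : FreeMonoid ℕ →* WordGroup :=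
  FreeMonoid.lift fun j => (FreeMonoid.ofList (block j), 1)

theorem blockHom_apply (l : FreeMonoid ℕ) :
    blockHom l = (FreeMonoid.ofList (l.toList.flatMap block), 1) := by
  induction l using FreeMonoid.inductionOn' with
  | one => rfl
  | of_mul a l ih =>
    rw [map_mul, ih, blockHom, FreeMonoid.lift_eval_of, Prod.mk_mul_mk, mul_one,
      ← FreeMonoid.ofList_append]
    rfl

/-- Let `m` be a monomial of `f` with nonzero coefficient. Each variable is replaced by the sum of
the blocks indexed by its positions in `m`. As blocks form a code, the word `block 0 ⋯ block (d -
1)` arises only from `m`, and only once, so its coefficient in the value of `f` is that of `m`. -/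
theorem not_isPI_exampleAlg : ¬ IsPI K (exampleAlg K) := by
  rintro ⟨f, hf, hρ⟩
  let e := FreeAlgebra.equivMonoidAlgebraFreeMonoid (R := K) (X := ℕ)
  have hf' : e f ≠ 0 := (map_ne_zero_iff e e.injective).2 hf
  obtain ⟨m, hm⟩ : ∃ m, (e f).coeff m ≠ 0 := by
    by_contra! h
    exact hf' (by ext m; exact h m)
  set d := m.toList.length with hd
  set g : ℕ → ℕ := fun j => m.toList.getD j 0 with hg
  have hgm : (List.range d).map g = m.toList := by
    refine List.ext_getElem (by simp [hd]) fun i h1 h2 => ?_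
    simp [hg, List.getElem?_eq_getElem h2]
  let ρ : ℕ → exampleAlg K := fun n => ∑ j ∈ Finset.range d with g j = n, wordElem K (block j)
  let θ : MonoidAlgebra K (FreeMonoid ℕ) →ₐ[K] MonoidAlgebra (MonomialAlg K) IrvingGroup :=
    MonoidAlgebra.lift K _ _ ((basisElem K).comp blockHom)
  let η : MonoidAlgebra K (FreeMonoid ℕ) →ₐ[K] MonoidAlgebra K (FreeMonoid ℕ) :=
    MonoidAlgebra.lift K _ _ (FreeMonoid.lift (fibreSum K g d))
  have h1 : (exampleAlg K).val.comp (FreeAlgebra.lift K ρ) = θ.comp (η.comp e.toAlgHom) := by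
    refine FreeAlgebra.hom_ext (funext fun n => ?_)
    have he : e (FreeAlgebra.ι K n) = MonoidAlgebra.single (FreeMonoid.of n) 1 := by
      simp [e, FreeAlgebra.equivMonoidAlgebraFreeMonoid]
    simp only [Function.comp_apply, AlgHom.comp_apply, FreeAlgebra.lift_ι_apply,
      AlgEquiv.toAlgHom_apply, he, η, θ, MonoidAlgebra.lift_single, one_smul,
      FreeMonoid.lift_eval_of, fibreSum, map_sum, MonoidHom.comp_apply, ρ, blockHom_apply]
    refine Finset.sum_congr rfl fun j _ => ?_
    simp [wordElem]
  let W : WordGroup := (FreeMonoid.ofList ((List.range d).flatMap block), 1)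
  have hW : IsSubword W.1.toList := isSubword_blocks d
  have h2 : ∀ F, coord K W (θ F) = F.coeff (FreeMonoid.ofList (List.range d)) := by
    classical
    intro F
    induction F using MonoidAlgebra.induction_linear with
    | zero => simp
    | add F G hF hG => simp [hF, hG]
    | single l c =>
      simp only [θ, MonoidAlgebra.lift_single, map_smul, MonoidHom.comp_apply, coord_basisElem,
        MonoidAlgebra.coeff_single, Finsupp.single_apply, smul_eq_mul, mul_ite, mul_one, mul_zero]
      refine if_congr ?_ rfl rfl
      rw [blockHom_apply]
      constructor
      · rintro ⟨-, h⟩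
        exact FreeMonoid.toList.injective (flatMap_block_injective
          (congrArg (fun z : WordGroup => z.1.toList) h))
      · rintro rfl
        exact ⟨hW, rfl⟩
  have h3 : ∀ F, (η F).coeff (FreeMonoid.ofList (List.range d)) = F.coeff m := by
    classical
    intro F
    induction F using MonoidAlgebra.induction_linear with
    | zero => simp
    | add F G hF hG => simp [hF, hG]
    | single l c =>
      simp only [η, MonoidAlgebra.lift_single, MonoidAlgebra.coeff_smul, Finsupp.smul_apply,
        FreeMonoid.lift_apply, coeff_prod_fibreSum, MonoidAlgebra.coeff_single,
        Finsupp.single_apply, smul_eq_mul, mul_ite, mul_one, mul_zero]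
      refine if_congr ?_ rfl rfl
      rw [hgm]
      constructor
      · rintro ⟨h, -⟩
        exact FreeMonoid.toList.injective h.symm
      · rintro rfl
        exact ⟨rfl, fun j hj => List.mem_range.1 hj⟩
  have h4 := DFunLike.congr_fun h1 f
  simp only [AlgHom.comp_apply, hρ ρ, map_zero] at h4
  have h5 := h3 (e f)
  rw [← h2] at h5
  refine hm (h5.symm.trans ?_)
  rw [show θ (η (e f)) = 0 from h4.symm, map_zero]

end PolynomialIdentities

end Structure

/-! ### Central elements of the Martindale quotient. -/

section CentralElements

variable {R : Type u} [Ring R] [IsPrimeRing R]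

/-- The class of a partial homomorphism in the Martindale ring of quotients. -/
def PartialHom.toQuotient (f : PartialHom R) : MartindaleQuotient R :=
  Quotient.mk (PartialHom.setoid R) f

/-- A partial homomorphism that respects left multiplications is central in the Martindale ring
of quotients. -/
theorem PartialHom.mul_toQuotient_comm (f : PartialHom R)
    (hf : ∀ (r x : R) (hx : x ∈ f.dom),
      f.map ⟨r * x, f.dom.mul_mem_left r x hx⟩ = r * f.map ⟨x, hx⟩)
    (q : MartindaleQuotient R) :
    q * f.toQuotient = f.toQuotient * q := by
  obtain ⟨g⟩ := q
  refine Quotient.sound (PartialHom.rel_of_agree fun x h1 h2 => ?_)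
  -- After right multiplication by `r * c₀` both composites become `g (x * f (r * c₀))`, since `f`
  -- is linear on both sides. Primeness then removes the factor `c₀`.
  obtain ⟨c₀, hc₀, hc₀0⟩ := exists_ne_zero f.dom_ne_bot
  have hgx : x ∈ g.dom := PartialHom.compDom_le f g h2
  have hfx : x ∈ f.dom := PartialHom.compDom_le g f h1
  have hgf : f.map ⟨x, hfx⟩ ∈ g.dom := PartialHom.map_mem_of_mem_compDom h1
  have hfg : g.map ⟨x, hgx⟩ ∈ f.dom := PartialHom.map_mem_of_mem_compDom h2
  change g.map ⟨f.map ⟨x, hfx⟩, hgf⟩ = f.map ⟨g.map ⟨x, hgx⟩, hfg⟩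
  rw [← sub_eq_zero]
  refine (IsPrimeRing.eq_zero_or _ c₀ fun r => ?_).resolve_right hc₀0
  have hc : r * c₀ ∈ f.dom := f.dom.mul_mem_left r c₀ hc₀
  rw [mul_assoc, sub_mul, sub_eq_zero, ← g.map_mul hgf _ (g.dom.mul_mem_right _ _ hgf),
    ← f.map_mul hfg _ (f.dom.mul_mem_right _ _ hfg), hf _ _ hc,
    ← g.map_mul hgx _ (g.dom.mul_mem_right _ _ hgx)]
  refine g.map_congr ?_ _ _
  rw [← f.map_mul hfx _ (f.dom.mul_mem_right _ _ hfx), hf _ _ hc]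

end CentralElements

/-! ### Transcendence degree of the extended centre. -/

section ExtendedCentre

open Pointwise

variable (K : Type u) [Field K]

/-- The pairs `(w, g)` with `w` containing `r` letters `x` more than needed. -/
def surplus (r : ℕ) : Set WordGroup := {q | ∃ k, k + r ≤ xCount q ∧ q.2 ∈ groupGens ^ k}

theorem mul_mem_surplus_left (r : ℕ) : ∀ q ∈ admissible, ∀ q' ∈ surplus r, q * q' ∈ surplus r := by
  rintro q hq q' ⟨k, hk, hq'⟩
  exact ⟨xCount q + k, by rw [xCount_mul]; omega, mul_mem_ball hq hq'⟩

theorem mul_mem_surplus_right (r : ℕ) :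
    ∀ q ∈ surplus r, ∀ q' ∈ admissible, q * q' ∈ surplus r := by
  rintro q ⟨k, hk, hq⟩ q' hq'
  exact ⟨k + xCount q', by rw [xCount_mul]; omega, mul_mem_ball hq hq'⟩

/-- The ideal spanned by the basis elements whose word contains `r` letters `x` more than
needed. -/
def surplusIdeal (r : ℕ) : TwoSidedIdeal (exampleAlg K) :=
  idealOf K (surplus r) (mul_mem_surplus_left r) (mul_mem_surplus_right r)

theorem surplusIdeal_ne_bot (r : ℕ) : surplusIdeal K r ≠ ⊥ := by
  refine ne_bot_of_mem (a := wordElem K (word r)) ((mem_idealOf K).2 ?_)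
    (wordElem_ne_zero K (isSubword_word r))
  refine Submodule.subset_span ⟨(FreeMonoid.ofList (word r), 1), ⟨0, ?_, by simp⟩, rfl⟩
  rw [zero_add]
  exact Nat.lt_two_pow_self.le.trans (count_word r).ge

theorem exists_gen_z_mem_ball (n : ℤ) : ∃ r, gen (.z n) ∈ groupGens ^ r := exists_mem_ball _

/-- The image of a generator `z n` in `A[G]`. -/
def zElem (n : ℤ) : MonoidAlgebra (MonomialAlg K) IrvingGroup := basisElem K (1, gen (.z n))

theorem zElem_comm (n : ℤ) (b : exampleAlg K) : zElem K n * b.1 = b.1 * zElem K n := by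
  have : Submodule.span K (basisElem K '' admissible) ≤
      (Subalgebra.centralizer K {zElem K n}).toSubmodule := by
    rw [Submodule.span_le]
    rintro _ ⟨q, -, rfl⟩
    rw [SetLike.mem_coe, Subalgebra.mem_toSubmodule, Subalgebra.mem_centralizer_iff]
    rintro _ rfl
    rw [zElem, ← map_mul, ← map_mul]
    congr 1
    exact Prod.ext ((one_mul _).trans (mul_one _).symm) (gen_z_comm n q.2)
  exact (Subalgebra.mem_centralizer_iff K).1 (this (mem_span_admissible K b)) _ rfl

/-- The `r` spare letters `x` pay for the `r` group generators whose product is `z n`. -/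
theorem zElem_mul_mem {n : ℤ} {r : ℕ} (hr : gen (.z n) ∈ groupGens ^ r) {b : exampleAlg K}
    (hb : b ∈ surplusIdeal K r) : zElem K n * b.1 ∈ exampleAlg K := by
  rw [← Subalgebra.mem_toSubmodule, exampleAlg_eq_span]
  refine mul_mem_span_basisElem K (P := {(1, gen (.z n))}) ?_ (Submodule.subset_span ⟨_, rfl, rfl⟩)
    ((mem_idealOf K).1 hb)
  rintro _ rfl q ⟨k, hk, hq⟩
  refine mem_admissible.2 (ball_mono ?_ (mul_mem_ball hr hq))
  rw [xCount_mul]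
  omega

/-- Multiplication by `z n`, as a partial homomorphism. -/
def zPartial (n : ℤ) : PartialHom (exampleAlg K) where
  dom := surplusIdeal K (exists_gen_z_mem_ball n).choose
  dom_ne_bot := surplusIdeal_ne_bot K _
  map :=
    { toFun := fun x => ⟨zElem K n * x.1.1,
        zElem_mul_mem K (exists_gen_z_mem_ball n).choose_spec x.2⟩
      map_add' := fun x y => Subtype.ext (mul_add (zElem K n) x.1.1 y.1.1)
      map_smul' := fun r x => Subtype.ext (mul_assoc (zElem K n) x.1.1 r.unop.1).symm }

theorem zPartial_apply (n : ℤ) (x : exampleAlg K) (hx : x ∈ (zPartial K n).dom) :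
    ((zPartial K n).map ⟨x, hx⟩).1 = zElem K n * x.1 := rfl

/-- The class of `z n` in the extended centre. -/
def zCentral (n : ℤ) : ExtendedCentre (exampleAlg K) K :=
  ⟨(zPartial K n).toQuotient, Subalgebra.mem_center_iff.2 fun q =>
    PartialHom.mul_toQuotient_comm _ (fun r x hx => Subtype.ext (by
      rw [zPartial_apply, Subalgebra.coe_mul, Subalgebra.coe_mul, zPartial_apply, ← mul_assoc,
        zElem_comm, mul_assoc])) q⟩

/-- An element of the Martindale ring of quotients is represented by an element of `A[G]` if it is
the class of a left multiplication by that element. -/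
def Represents (q : MartindaleQuotient (exampleAlg K))
    (a : MonoidAlgebra (MonomialAlg K) IrvingGroup) : Prop :=
  ∃ f : PartialHom (exampleAlg K), q = f.toQuotient ∧
    ∀ x (hx : x ∈ f.dom), (f.map ⟨x, hx⟩).1 = a * x.1

variable {K}

theorem Represents.add {q r : MartindaleQuotient (exampleAlg K)}
    {a b : MonoidAlgebra (MonomialAlg K) IrvingGroup} (h : Represents K q a)
    (k : Represents K r b) : Represents K (q + r) (a + b) := by
  obtain ⟨f, rfl, hf⟩ := h
  obtain ⟨g, rfl, hg⟩ := k
  refine ⟨f.add g, rfl, fun x hx => ?_⟩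
  rw [add_mul, ← hf x ((inf_le_left : f.dom ⊓ g.dom ≤ _) hx),
    ← hg x ((inf_le_right : f.dom ⊓ g.dom ≤ _) hx)]
  rfl

theorem Represents.mul {q r : MartindaleQuotient (exampleAlg K)}
    {a b : MonoidAlgebra (MonomialAlg K) IrvingGroup} (h : Represents K q a)
    (k : Represents K r b) : Represents K (q * r) (a * b) := by
  obtain ⟨f, rfl, hf⟩ := h
  obtain ⟨g, rfl, hg⟩ := k
  refine ⟨f.comp g, rfl, fun x hx => ?_⟩
  rw [mul_assoc, ← hg x (PartialHom.compDom_le f g hx)]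
  exact hf _ (PartialHom.map_mem_of_mem_compDom hx)

theorem represents_algebraMap (c : K) : Represents K
    (algebraMap K (MartindaleQuotient (exampleAlg K)) c)
    (algebraMap K (MonoidAlgebra (MonomialAlg K) IrvingGroup) c) :=
  ⟨PartialHom.ofElem (algebraMap K (exampleAlg K) c), rfl, fun _ _ => rfl⟩

theorem represents_zCentral (n : ℤ) : Represents K (zCentral K n).1 (zElem K n) :=
  ⟨zPartial K n, rfl, zPartial_apply K n⟩

theorem Represents.exists_mul_eq_zero {a : MonoidAlgebra (MonomialAlg K) IrvingGroup}
    (h : Represents K 0 a) : ∃ x : exampleAlg K, x ≠ 0 ∧ a * x.1 = 0 := by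
  obtain ⟨f, hf, h⟩ := h
  obtain ⟨J, hJ, h0, h1, h2⟩ := Quotient.exact hf
  obtain ⟨x, hx, hx0⟩ := exists_ne_zero hJ
  refine ⟨x, hx0, ?_⟩
  rw [← h x (h1 hx), ← h2 x hx]
  change ((0 : exampleAlg K) * x).1 = 0
  rw [zero_mul]
  rfl

variable (K)

/-- The monomials in the `z n`. -/
def zMonomial : Multiplicative (ℤ →₀ ℕ) →* WordGroup :=
  (MonoidHom.inr _ _).comp (zHom.comp (AddMonoidHom.toMultiplicative
    ((AddMonoidAlgebra.coeffAddEquiv (R := ℤ) (M := ℤ)).symm.toAddMonoidHom.comp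
      (Finsupp.mapRange.addMonoidHom (Nat.castAddMonoidHom ℤ)))))

theorem zMonomial_injective : Function.Injective zMonomial := by
  intro d e h
  have h1 := zHom_injective (congrArg Prod.snd h)
  have h2 := (AddMonoidAlgebra.coeffAddEquiv (R := ℤ) (M := ℤ)).symm.injective
    (congrArg Multiplicative.toAdd h1)
  exact congrArg Multiplicative.ofAdd
    (Finsupp.mapRange_injective _ Nat.cast_zero Nat.cast_injective h2)

theorem zMonomial_single (n : ℤ) :
    zMonomial (.ofAdd (Finsupp.single n 1)) = (1, gen (.z n)) := by
  rw [← zHom_T]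
  simp only [zMonomial, MonoidHom.comp_apply, MonoidHom.inr_apply]
  congr 2
  simp only [AddMonoidHom.toMultiplicative_apply_apply, toAdd_ofAdd, AddMonoidHom.comp_apply,
    Finsupp.mapRange.addMonoidHom_apply, Finsupp.mapRange_single]
  simp

/-- Polynomials in the `z n`. -/
def zPoly : MvPolynomial ℤ K →ₐ[K] MonoidAlgebra K WordGroup :=
  AddMonoidAlgebra.lift K _ _ ((MonoidAlgebra.of K WordGroup).comp zMonomial)

theorem zPoly_monomial (d : ℤ →₀ ℕ) (c : K) :
    zPoly K (MvPolynomial.monomial d c) = MonoidAlgebra.single (zMonomial (.ofAdd d)) c := by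
  refine (AddMonoidAlgebra.lift_single _ _ _).trans ?_
  simp

theorem coeff_zPoly (p : MvPolynomial ℤ K) (d : ℤ →₀ ℕ) :
    (zPoly K p).coeff (zMonomial (.ofAdd d)) = p.coeff d := by
  classical
  induction p using MvPolynomial.induction_on' with
  | monomial e c =>
    rw [zPoly_monomial, MonoidAlgebra.coeff_single, MvPolynomial.coeff_monomial,
      Finsupp.single_apply]
    exact if_congr (zMonomial_injective.eq_iff.trans Multiplicative.ofAdd.injective.eq_iff) rfl rfl
  | add p q hp hq => rw [map_add, MonoidAlgebra.coeff_add, Finsupp.add_apply, hp, hq,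
      MvPolynomial.coeff_add]

theorem zPoly_injective : Function.Injective (zPoly K) := by
  refine (injective_iff_map_eq_zero _).2 fun p hp => ?_
  ext d
  rw [← coeff_zPoly, hp]
  rfl

theorem fst_eq_one_of_mem_support_zPoly (p : MvPolynomial ℤ K) {q : WordGroup}
    (hq : q ∈ (zPoly K p).coeff.support) : q.1 = 1 := by
  classical
  induction p using MvPolynomial.induction_on' with
  | monomial e c =>
    rw [zPoly_monomial, MonoidAlgebra.coeff_single] at hq
    rw [Finset.mem_singleton.1 (Finsupp.support_single_subset hq)]
    rfl
  | add p p' hp hp' =>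
    rw [map_add, MonoidAlgebra.coeff_add] at hq
    exact (Finset.mem_union.1 (Finsupp.support_add hq)).elim hp hp'

theorem represents_aeval_zCentral (p : MvPolynomial ℤ K) :
    Represents K (MvPolynomial.aeval (zCentral K) p).1 (toExample K (zPoly K p)) := by
  induction p using MvPolynomial.induction_on with
  | C c =>
    have h : zPoly K (MvPolynomial.C c) = algebraMap K _ c := (zPoly K).commutes c
    rw [MvPolynomial.aeval_C, h, AlgHom.commutes]
    exact represents_algebraMap c
  | add p q hp hq =>
    rw [map_add, map_add, map_add]
    exact hp.add hq
  | mul_X p n hp =>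
    have h : toExample K (zPoly K (MvPolynomial.X n)) = zElem K n := by
      rw [MvPolynomial.X, zPoly_monomial, zMonomial_single, toExample_single, one_smul]
      rfl
    rw [map_mul, map_mul, map_mul, MvPolynomial.aeval_X, h]
    exact hp.mul (represents_zCentral n)

/-- By `represents_aeval_zCentral` a relation would give a nonzero polynomial in the `z n` that
annihilates a nonzero `x` in `A[G]`. The polynomial involves only the empty word, so the surviving
term keeps a word of `x`, which is a subword. -/
theorem algebraicIndependent_zCentral : AlgebraicIndependent K (zCentral K) := by
  rw [algebraicIndependent_iff]
  intro p hp
  by_contra hp0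
  have h := represents_aeval_zCentral K p
  rw [hp] at h
  obtain ⟨x, hx, hpx⟩ := h.exists_mul_eq_zero
  obtain ⟨f, hf, hfx⟩ := exists_toExample K x
  have hf0 : f ≠ 0 := fun h0 => hx (Subtype.ext (by rw [← hfx, h0, map_zero]; rfl))
  obtain ⟨q, hq, r, hr, hqr⟩ := exists_coeff_mul_single_mul K
    ((map_ne_zero_iff _ (zPoly_injective K)).2 hp0) hf0
  have hu : IsSubword (q * ((1, 1) : WordGroup) * r).1.toList := by
    have : (q * ((1, 1) : WordGroup) * r).1 = r.1 := by
      simp [fst_eq_one_of_mem_support_zPoly K p hq]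
    rw [this]
    exact (hf r hr).1
  refine toExample_ne_zero K hu (hqr 1) ?_
  have h1 : MonoidAlgebra.single ((1, 1) : WordGroup) (1 : K) = 1 := MonoidAlgebra.one_def.symm
  rw [h1, mul_one, map_mul, hfx, hpx]

theorem aleph0_le_trdeg :
    Cardinal.aleph0 ≤ Algebra.trdeg K (ExtendedCentre (exampleAlg K) K) := by
  have := (algebraicIndependent_zCentral K).lift_cardinalMk_le_trdeg
  simpa using this

end ExtendedCentre

/-! ### Gelfand-Kirillov dimension. -/

section Growth

open Pointwise Filter Topology

/-- The least such `j` works: for `j > 0` minimality gives `p j ≤ N`, which bounds the length, and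
the iterated exponentials in `p j` make `(2 ^ j) ^ 2` at most `4 * log N`. The summands `1` cover `j
= 0`. -/
theorem exists_index (N : ℕ) : ∃ j, N < p (j + 1) ∧
    (word j).length ≤ 3 * N + 1 ∧ (2 ^ j : ℝ) ≤ 1 + 2 * √(Real.log N) := by
  have hex : ∃ j, N < p (j + 1) := ⟨N, (Nat.lt_succ_self N).trans_le (self_le_p _)⟩
  classical
  obtain ⟨j, hj, hmin⟩ : ∃ j, N < p (j + 1) ∧ ∀ i < j, ¬ N < p (i + 1) :=
    ⟨Nat.find hex, Nat.find_spec hex, fun i hi => Nat.find_min hex hi⟩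
  refine ⟨j, hj, ?_⟩
  cases j with
  | zero =>
    refine ⟨by simp [word], ?_⟩
    have := Real.sqrt_nonneg (Real.log N)
    rw [pow_zero]
    linarith
  | succ i =>
    have hp : p (i + 1) ≤ N := not_lt.1 (hmin i (Nat.lt_succ_self i))
    refine ⟨(length_word_succ_le i).trans (by omega), ?_⟩
    have h1 : (2 ^ (i + 1)) ^ 2 ≤ 2 ^ 2 ^ 2 ^ (i + 1) := by
      rw [← pow_mul]
      refine Nat.pow_le_pow_right (by norm_num) ?_
      have h2 : i < 2 ^ i := Nat.lt_two_pow_self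
      have h3 : 2 ^ (i + 1) < 2 ^ 2 ^ (i + 1) := Nat.lt_two_pow_self
      rw [pow_succ] at h3 ⊢
      omega
    have h2 : ((2 : ℝ) ^ 2 ^ 2 ^ (i + 1)) * Real.log 2 ≤ Real.log N := by
      have h3 : (p (i + 1) : ℝ) ≤ N := by exact_mod_cast hp
      have h4 : (p (i + 1) : ℝ) = 2 ^ (2 ^ 2 ^ 2 ^ (i + 1)) := by simp [p]
      rw [h4] at h3
      have := Real.log_le_log (by positivity) h3
      rw [Real.log_pow] at this
      push_cast at this
      exact this
    have h3 : ((2 : ℝ) ^ (i + 1)) ^ 2 ≤ 2 ^ 2 ^ 2 ^ (i + 1) := by exact_mod_cast h1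
    have h4 : (0.5 : ℝ) ≤ Real.log 2 := by linarith [Real.log_two_gt_d9]
    have h5 : ((2 : ℝ) ^ (i + 1)) ^ 2 ≤ 4 * Real.log N := by nlinarith
    have h6 : (2 : ℝ) ^ (i + 1) ≤ √(4 * Real.log N) := Real.le_sqrt_of_sq_le h5
    rw [Real.sqrt_mul (by norm_num), show (4 : ℝ) = 2 ^ 2 by norm_num,
      Real.sqrt_sq (by norm_num)] at h6
    linarith

theorem infix_mem_image {α : Type*} [DecidableEq α] {w v : List α} (h : w <:+: v) {N : ℕ}
    (hN : w.length ≤ N) : w ∈ (Finset.range (v.length + 1) ×ˢ Finset.range (N + 1)).image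
      fun i => (v.drop i.1).take i.2 := by
  obtain ⟨s, t, rfl⟩ := h
  refine Finset.mem_image.2 ⟨(s.length, w.length), ?_, by simp⟩
  simp only [Finset.mem_product, Finset.mem_range, List.length_append]
  omega

/-- The pairs that give basis elements of length at most `N` are nearly quadratic in number. -/
theorem exists_finset_basisSet : ∃ c : ℕ, 1 ≤ c ∧ ∀ N : ℕ,
    ∃ (F : Finset WordGroup) (j : ℕ), (∀ q ∈ basisSet, wordLength q ≤ N → q ∈ F) ∧
      (2 ^ j : ℝ) ≤ 1 + 2 * √(Real.log N) ∧ F.card ≤ 5 * (N + 1) ^ 2 * c ^ 2 ^ j := by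
  classical
  set S := groupGens_finite.toFinset with hS
  have hS' : (S : Set IrvingGroup) = groupGens := groupGens_finite.coe_toFinset
  refine ⟨S.card, Finset.card_pos.2 ⟨1, by simp [hS, one_mem_groupGens]⟩, fun N => ?_⟩
  obtain ⟨j, hj, hl, hlog⟩ := exists_index N
  -- Every subword of length at most `N` is a window of `v`, given by its start and its length, and
  -- its group part lies in the ball of radius `2 ^ j`.
  let v := ys (N + 1) ++ word j ++ ys (N + 1)
  let W : Finset (List Letter) := (Finset.range (v.length + 1) ×ˢ Finset.range (N + 1)).image
      fun i => (v.drop i.1).take i.2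
  refine ⟨(W ×ˢ (S ^ 2 ^ j)).image fun i => (FreeMonoid.ofList i.1, i.2), j, ?_, hlog, ?_⟩
  · rintro ⟨w, g⟩ ⟨hw, hg⟩ hwl
    refine Finset.mem_image.2 ⟨(w.toList, g), Finset.mem_product.2 ⟨?_, ?_⟩, rfl⟩
    · exact infix_mem_image (hw.infix_of_length_lt hj (Nat.lt_succ_of_le hwl)) hwl
    · rw [← Finset.mem_coe, Finset.coe_pow, hS']
      exact ball_mono (hw.count_le (lt_of_le_of_lt hwl hj)) hg
  · refine Finset.card_image_le.trans ?_
    rw [Finset.card_product]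
    refine Nat.mul_le_mul (Finset.card_image_le.trans ?_) Finset.card_pow_le
    rw [Finset.card_product, Finset.card_range, Finset.card_range]
    have : v.length = (word j).length + 2 * (N + 1) := by
      simp [v]; ring
    rw [this, pow_two, ← mul_assoc]
    exact Nat.mul_le_mul_right _ (by omega)

variable (K : Type u) [Field K]

/-- The subspace spanned by the products of at most `N` generators. -/
def lengthLE (N : ℕ) : Submodule K (exampleAlg K) :=
  spanOf K {q | q ∈ admissible ∧ wordLength q ≤ N}

theorem lengthLE_mul_le (m n : ℕ) : lengthLE K m * lengthLE K n ≤ lengthLE K (m + n) :=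
  Submodule.mul_le.2 fun _ hb _ hc =>
    mul_mem_spanOf K (R := {q | q ∈ admissible ∧ wordLength q ≤ m + n})
      (fun q hq r hr => ⟨mul_mem hq.1 hr.1, by
        rw [wordLength_mul]; exact add_le_add hq.2 hr.2⟩) hb hc

theorem one_mem_lengthLE (n : ℕ) : 1 ∈ lengthLE K n :=
  Submodule.subset_span ⟨1, ⟨one_mem admissible, Nat.zero_le _⟩, map_one (basisElem K)⟩

theorem pow_le_lengthLE {V : Submodule K (exampleAlg K)} {d : ℕ} (hV : V ≤ lengthLE K d) (n : ℕ) :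
    V ^ n ≤ lengthLE K (d * n) := by
  induction n with
  | zero => rw [pow_zero, Submodule.one_le]; exact one_mem_lengthLE K _
  | succ n ih =>
    rw [pow_succ, mul_add, mul_one]
    exact (mul_le_mul' ih hV).trans (lengthLE_mul_le K _ _)

theorem exists_le_lengthLE (V : Submodule K (exampleAlg K)) [FiniteDimensional K V] :
    ∃ d, 1 ≤ d ∧ V ≤ lengthLE K d := by
  obtain ⟨s, rfl⟩ := Module.Finite.iff_fg.1 ‹FiniteDimensional K V›
  have h (b : exampleAlg K) := exists_wordLength_le K (mem_span_admissible K b)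
  choose N hN using h
  refine ⟨s.sup N + 1, by omega, Submodule.span_le.2 fun b hb => hN b _ ?_⟩
  exact (Finset.le_sup hb).trans (Nat.le_succ _)

theorem map_lengthLE_le {N : ℕ} {F : Finset WordGroup}
    (hF : ∀ q ∈ basisSet, wordLength q ≤ N → q ∈ F) :
    (lengthLE K N).map (exampleAlg K).val.toLinearMap ≤
      Submodule.span K (basisElem K '' F) := by
  rintro _ ⟨b, hb, rfl⟩
  refine (Submodule.span_le.2 ?_ :
    Submodule.span K (basisElem K '' {q | q ∈ admissible ∧ wordLength q ≤ N}) ≤ _) hb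
  rintro _ ⟨q, ⟨hq, hqN⟩, rfl⟩
  by_cases hs : IsSubword q.1.toList
  · exact Submodule.subset_span ⟨q, hF q ⟨hs, hq⟩ hqN, rfl⟩
  · rw [basisElem_eq_zero K hs]
    exact Submodule.zero_mem _

theorem finrank_le_card {V : Submodule K (exampleAlg K)} {N : ℕ} (hV : V ≤ lengthLE K N)
    {F : Finset WordGroup} (hF : ∀ q ∈ basisSet, wordLength q ≤ N → q ∈ F) :
    FiniteDimensional K V ∧ Module.finrank K V ≤ F.card := by
  classical
  have hi : Function.Injective (exampleAlg K).val.toLinearMap := Subtype.val_injective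
  let e := Submodule.equivMapOfInjective _ hi V
  have h1 : V.map (exampleAlg K).val.toLinearMap ≤
      Submodule.span K ((F.image (basisElem K) : Finset _) : Set _) := by
    rw [Finset.coe_image]
    exact (Submodule.map_mono hV).trans (map_lengthLE_le K hF)
  have : FiniteDimensional K (V.map (exampleAlg K).val.toLinearMap) :=
    Submodule.finiteDimensional_of_le h1
  refine ⟨LinearEquiv.finiteDimensional e.symm, ?_⟩
  rw [e.finrank_eq]
  exact (Submodule.finrank_mono h1).trans
    ((finrank_span_finset_le_card _).trans Finset.card_image_le)

theorem finiteDimensional_lengthLE (N : ℕ) : FiniteDimensional K (lengthLE K N) := by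
  obtain ⟨c, -, hc⟩ := exists_finset_basisSet
  obtain ⟨F, -, hF, -, -⟩ := hc N
  exact (finrank_le_card K le_rfl hF).1

theorem tendsto_log_natCast_atTop : Tendsto (fun n : ℕ => Real.log n) atTop atTop :=
  Real.tendsto_log_atTop.comp tendsto_natCast_atTop_atTop

theorem limsup_le_two (V : Submodule K (exampleAlg K)) [FiniteDimensional K V] :
    limsup (fun n : ℕ =>
      ((Real.log (Module.finrank K (V ^ n : Submodule K (exampleAlg K))) / Real.log n : ℝ) : EReal))
      atTop ≤ 2 := by
  obtain ⟨d, hd, hV⟩ := exists_le_lengthLE K V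
  obtain ⟨c, hc1, hc⟩ := exists_finset_basisSet
  have hlc : 0 ≤ Real.log c := Real.log_natCast_nonneg c
  -- For `n ≥ d` one has `√(log (d * n)) ≤ 2 * √(log n)`, so `2 ^ j ≤ 1 + 4 * √(log n)`. The `1`
  -- contributes `log c` to `A`, the rest gives `B`.
  set A : ℝ := Real.log 5 + 2 * Real.log (2 * d) + Real.log c with hA
  set B : ℝ := 4 * Real.log c with hB
  let g : ℕ → ℝ := fun n => A / Real.log n + B / √(Real.log n) + 2
  have hg : Tendsto g atTop (𝓝 2) := by
    have h1 : Tendsto (fun n : ℕ => A / Real.log n) atTop (𝓝 0) :=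
      tendsto_const_nhds.div_atTop tendsto_log_natCast_atTop
    have h2 : Tendsto (fun n : ℕ => B / √(Real.log n)) atTop (𝓝 0) :=
      tendsto_const_nhds.div_atTop (Real.tendsto_sqrt_atTop.comp tendsto_log_natCast_atTop)
    simpa using (h1.add h2).add_const 2
  have hg' : Tendsto (fun n => ((g n : ℝ) : EReal)) atTop (𝓝 ((2 : ℝ) : EReal)) :=
    (continuous_coe_real_ereal.tendsto 2).comp hg
  refine le_of_le_of_eq (limsup_le_limsup ?_) hg'.limsup_eq
  filter_upwards [eventually_ge_atTop (max d 2)] with n hn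
  have hnd : d ≤ n := (le_max_left _ _).trans hn
  have hn2 : 2 ≤ n := (le_max_right _ _).trans hn
  refine EReal.coe_le_coe_iff.2 ?_
  have hdn : 1 ≤ d * n := Nat.one_le_iff_ne_zero.2 (by positivity)
  obtain ⟨F, j, hF, hj, hcard⟩ := hc (d * n)
  have hfin := (finrank_le_card K (pow_le_lengthLE K hV n) hF).2.trans hcard
  have hln : 0 < Real.log n := Real.log_pos (by exact_mod_cast hn2)
  have hd0 : (0 : ℝ) < d := by exact_mod_cast hd
  have hn0 : (0 : ℝ) < n := by positivity
  have hc0 : (0 : ℝ) < c := by exact_mod_cast hc1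
  have hbound : Real.log (Module.finrank K (V ^ n : Submodule K (exampleAlg K))) ≤
      Real.log (5 * (2 * d * n) ^ 2 * c ^ 2 ^ j) := by
    have h1 : (Module.finrank K (V ^ n : Submodule K (exampleAlg K)) : ℝ) ≤
        5 * (2 * d * n) ^ 2 * c ^ 2 ^ j := by
      have h2 : (Module.finrank K (V ^ n : Submodule K (exampleAlg K)) : ℝ) ≤
          5 * (d * n + 1) ^ 2 * c ^ 2 ^ j := by exact_mod_cast hfin
      have h3 : (1 : ℝ) ≤ d * n := by exact_mod_cast hdn
      refine h2.trans ?_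
      gcongr
      linarith
    -- `V` is not assumed to contain `1`, so the dimension may be `0`; then `Real.log 0 = 0` is
    -- used.
    obtain h0 | h0 := Nat.eq_zero_or_pos (Module.finrank K (V ^ n : Submodule K (exampleAlg K)))
    · rw [h0, Nat.cast_zero, Real.log_zero]
      refine Real.log_nonneg ?_
      have : 1 ≤ 5 * (2 * d * n) ^ 2 * c ^ 2 ^ j := Nat.one_le_iff_ne_zero.2 (by positivity)
      exact_mod_cast this
    · exact Real.log_le_log (by exact_mod_cast h0) h1
  have hlog : Real.log (5 * (2 * d * n) ^ 2 * c ^ 2 ^ j) =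
      Real.log 5 + 2 * (Real.log (2 * d) + Real.log n) + 2 ^ j * Real.log c := by
    rw [Real.log_mul (by positivity) (by positivity), Real.log_mul (by positivity) (by positivity),
      Real.log_pow, Real.log_pow, Real.log_mul (by positivity) (by positivity)]
    push_cast
    ring
  have hsq : √(Real.log (d * n : ℕ)) ≤ 2 * √(Real.log n) := by
    have h1 : Real.log (d * n : ℕ) ≤ 2 ^ 2 * Real.log n := by
      push_cast
      rw [Real.log_mul (by positivity) (by positivity)]
      have : Real.log d ≤ Real.log n := Real.log_le_log hd0 (by exact_mod_cast hnd)
      linarith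
    refine (Real.sqrt_le_sqrt h1).trans_eq ?_
    rw [Real.sqrt_mul (by norm_num), Real.sqrt_sq (by norm_num)]
  have hj' : (2 : ℝ) ^ j * Real.log c ≤ (1 + 4 * √(Real.log n)) * Real.log c :=
    mul_le_mul_of_nonneg_right (by linarith) hlc
  have hgn : g n = (A + B * √(Real.log n) + 2 * Real.log n) / Real.log n := by
    have h1 : √(Real.log n) * √(Real.log n) = Real.log n := Real.mul_self_sqrt hln.le
    have h2 : 0 < √(Real.log n) := Real.sqrt_pos.2 hln
    have h3 : B / √(Real.log n) = B * √(Real.log n) / Real.log n := by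
      rw [div_eq_div_iff h2.ne' hln.ne', mul_assoc B, h1]
    simp only [g]
    rw [h3]
    field_simp
  rw [hgn]
  refine div_le_div_of_nonneg_right ?_ hln.le
  rw [hlog] at hbound
  rw [hA, hB]
  linarith

theorem linearIndependent_wordElem {ι : Type*} {w : ι → List Letter} (hw : Function.Injective w)
    (hs : ∀ i, IsSubword (w i)) : LinearIndependent K fun i => wordElem K (w i) := by
  classical
  rw [linearIndependent_iff']
  intro s c hc i hi
  have := congrArg (fun b : exampleAlg K => coord K (FreeMonoid.ofList (w i), 1) b.1) hc
  simp only [AddSubmonoidClass.coe_finsetSum, Subalgebra.coe_smul, wordElem, map_sum, map_smul,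
    coord_basisElem, smul_eq_mul] at this
  rw [Finset.sum_eq_single i] at this
  · simpa [hs i] using this
  · intro k _ hk
    rw [if_neg, mul_zero]
    rintro ⟨-, h⟩
    exact hk (hw (FreeMonoid.ofList.injective (congrArg Prod.fst h)))
  · exact fun h => absurd hi h

theorem wordElem_mem_pow {w : List Letter} {n : ℕ} (hw : w.length ≤ n) :
    wordElem K w ∈ lengthLE K 1 ^ n := by
  induction n generalizing w with
  | zero =>
    obtain rfl : w = [] := List.eq_nil_of_length_eq_zero (by omega)
    rw [pow_zero]
    have h : wordElem K [] = 1 := Subtype.ext (map_one (basisElem K))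
    rw [h]
    exact Submodule.one_le.1 le_rfl
  | succ n ih =>
    rw [pow_succ']
    cases w with
    | nil =>
      have := Submodule.mul_mem_mul (one_mem_lengthLE K 1) (ih (w := []) (Nat.zero_le n))
      rwa [one_mul] at this
    | cons a w =>
      have h1 : wordElem K (a :: w) = wordElem K [a] * wordElem K w := by
        refine Subtype.ext ?_
        rw [Subalgebra.coe_mul, wordElem, wordElem, wordElem, ← map_mul, Prod.mk_mul_mk, mul_one]
        rfl
      rw [h1]
      refine Submodule.mul_mem_mul ?_ (ih (by simpa using hw))
      exact Submodule.subset_span ⟨_, ⟨word_mem_admissible _, le_of_eq rfl⟩, rfl⟩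

/-- The words `y ^ a` followed by a nonempty prefix of `word n` are subwords. They are distinct
because `word n` starts with `x`, which marks the end of the run of `y`. -/
theorem sq_le_finrank (n : ℕ) :
    (n / 2) ^ 2 ≤ Module.finrank K (lengthLE K 1 ^ n : Submodule K (exampleAlg K)) := by
  let w : Fin (n / 2) × Fin (n / 2) → List Letter := fun i =>
    ys i.1 ++ (word n).take (i.2 + 1)
  have hlen : ∀ i : Fin (n / 2), ((word n).take (i + 1)).length = i + 1 := fun i => by
    have := length_word_lt n
    rw [List.length_take]
    omega
  have hw : Function.Injective w := fun i k h => by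
    obtain ⟨r, hr⟩ := exists_word_eq_cons n
    have h1 : i.1.1 = k.1.1 := by
      have h' := h
      simp only [w, hr, List.take_succ_cons] at h'
      exact ys_append_cons_inj h'
    have h2 := congrArg List.length h
    simp only [w, List.length_append, List.length_replicate, hlen] at h2
    exact Prod.ext (Fin.ext h1) (Fin.ext (by omega))
  have hs : ∀ i, IsSubword (w i) := fun i => by
    refine (isSubword_ys_append_word n i.1).of_infix ?_
    exact ((List.prefix_append_right_inj _).2 (List.take_prefix _ _)).isInfix
  have hmem : ∀ i, wordElem K (w i) ∈ lengthLE K 1 ^ n := fun i => wordElem_mem_pow K (by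
    simp only [w, List.length_append, List.length_replicate, hlen]
    omega)
  have : FiniteDimensional K (lengthLE K 1 ^ n : Submodule K (exampleAlg K)) :=
    have := finiteDimensional_lengthLE K (1 * n)
    Submodule.finiteDimensional_of_le (pow_le_lengthLE K le_rfl n)
  have hli : LinearIndependent K
      fun i => (⟨wordElem K (w i), hmem i⟩ : (lengthLE K 1 ^ n : Submodule K (exampleAlg K))) :=
    LinearIndependent.of_comp (Submodule.subtype _) (linearIndependent_wordElem K hw hs)
  have := hli.fintype_card_le_finrank
  simpa [pow_two] using this

theorem two_le_limsup : 2 ≤ limsup (fun n : ℕ =>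
    ((Real.log (Module.finrank K (lengthLE K 1 ^ n : Submodule K (exampleAlg K))) /
      Real.log n : ℝ) : EReal)) atTop := by
  let g : ℕ → ℝ := fun n => 2 - Real.log 16 / Real.log n
  have hg : Tendsto g atTop (𝓝 2) := by
    have h1 : Tendsto (fun n : ℕ => Real.log 16 / Real.log n) atTop (𝓝 0) :=
      tendsto_const_nhds.div_atTop tendsto_log_natCast_atTop
    simpa using h1.const_sub 2
  have hg' : Tendsto (fun n => ((g n : ℝ) : EReal)) atTop (𝓝 ((2 : ℝ) : EReal)) :=
    (continuous_coe_real_ereal.tendsto 2).comp hg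
  refine le_of_eq_of_le hg'.limsup_eq.symm (limsup_le_limsup ?_)
  filter_upwards [eventually_ge_atTop 2] with n hn
  refine EReal.coe_le_coe_iff.2 ?_
  have hln : 0 < Real.log n := Real.log_pos (by exact_mod_cast hn)
  have hn0 : (0 : ℝ) < n := by positivity
  have h1 : n ^ 2 ≤ 16 * Module.finrank K (lengthLE K 1 ^ n : Submodule K (exampleAlg K)) := by
    have h2 := sq_le_finrank K n
    -- Valid for `n ≥ 2` despite the rounding in `n / 2`; squaring gives the constant `16`.
    have h3 : n ≤ 4 * (n / 2) := by omega
    nlinarith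
  have h2 : ((n : ℝ) ^ 2) / 16 ≤
      Module.finrank K (lengthLE K 1 ^ n : Submodule K (exampleAlg K)) := by
    rw [div_le_iff₀ (by norm_num), mul_comm]
    exact_mod_cast h1
  have h3 := Real.log_le_log (by positivity) h2
  rw [Real.log_div (by positivity) (by norm_num), Real.log_pow] at h3
  push_cast at h3
  rw [le_div_iff₀ hln]
  simp only [g]
  rw [sub_mul, div_mul_cancel₀ _ hln.ne']
  exact h3

theorem gkDim_exampleAlg : gkDim K (exampleAlg K) = 2 := by
  apply le_antisymm
  · exact iSup_le fun V => iSup_le fun _ => iSup_le fun _ => limsup_le_two K V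
  · exact (two_le_limsup K).trans (le_iSup_of_le (lengthLE K 1)
      (le_iSup_of_le (finiteDimensional_lengthLE K 1)
        (le_iSup_of_le (one_mem_lengthLE K 1) le_rfl)))

end Growth

end ExtCentre

end

theorem theorem1p4 (K : Type u) [Field K] :
    -- the centre of the group `G` is free abelian on the infinitely many generators `z n`
    (∃ e : Multiplicative (FreeAbelianGroup ℤ) ≃* Subgroup.center ExtCentre.IrvingGroup,
      ∀ n : ℤ, (e (Multiplicative.ofAdd (FreeAbelianGroup.of n)) : ExtCentre.IrvingGroup) =
        ExtCentre.gen (.z n)) ∧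
    -- `B` is finitely generated, not PI, and of GK dimension two
    Algebra.FiniteType K (ExtCentre.exampleAlg K) ∧
    ¬ ExtCentre.IsPI K (ExtCentre.exampleAlg K) ∧
    ExtCentre.gkDim K (ExtCentre.exampleAlg K) = 2 ∧
    -- `B` is graded, with the eight generators in degree one
    (∃ 𝒜 : ℕ → Submodule K (ExtCentre.exampleAlg K), Nonempty (GradedAlgebra 𝒜) ∧
      ∀ b : ExtCentre.exampleAlg K, b.1 ∈ ExtCentre.generators K → b ∈ 𝒜 1) ∧
    -- the ideal of `B` generated by `x` is nonzero and locally nilpotent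
    TwoSidedIdeal.span {ExtCentre.exampleX K} ≠ ⊥ ∧
    ExtCentre.IsLocallyNilpotent (TwoSidedIdeal.span {ExtCentre.exampleX K}) ∧
    -- `B` is prime, and its extended centre has infinite transcendence degree over `K`
    ∃ _ : ExtCentre.IsPrimeRing (ExtCentre.exampleAlg K),
      Cardinal.aleph0 ≤ Algebra.trdeg K (ExtCentre.ExtendedCentre (ExtCentre.exampleAlg K) K) :=
  ⟨ExtCentre.exists_center_equiv, ExtCentre.finiteType_exampleAlg K,
    ExtCentre.not_isPI_exampleAlg K, ExtCentre.gkDim_exampleAlg K, ExtCentre.exists_grading K,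
    ExtCentre.span_exampleX_ne_bot K, ExtCentre.isLocallyNilpotent_span_exampleX K,
    ExtCentre.isPrimeRing_exampleAlg K, ExtCentre.aleph0_le_trdeg K⟩
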